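/- We work in (many-sorted) continuous logic for metric structures. In a language $\mathcal L$ each sort $S$ carries a bound $B_S>0$, each function symbol a modulus of uniform continuity, and each relation symbol a bound and a modulus; an $\mathcal L$-structure interprets each sort $S$ as a complete non-empty metric space of diameter at most $B_S$, and the symbols as uniformly continuous functions and bounded real-valued uniformly continuous relations that respect these data. Basic formulas are built from relations and metrics applied to terms, using all continuous connectives $\mathbb R^k\to\mathbb R$ and the quantifiers $\sup_x$, $\inf_x$. For a set of sentences $T$, a structure $\mathcal M$ is a model of $T$ if $\varphi^{\mathcal M}=0$ for all $\varphi\in T$; a theory is a set of sentences that has a model. The $T$-formulas in a finite tuple of variables $\bar x$ form the completion $\mathrm{Form}_{\bar x}(T,\mathcal L)$ of the basic formulas for the seminorm $\|\varphi\|_T=\sup\{|\varphi^{\mathcal M}(\bar a)|:\mathcal M\models T,\ \bar a\in\mathcal M\}$; for $T=\emptyset$ they are called $\mathcal L$-formulas, and sentences are $\mathcal L$-formulas without free variables. Write $\chi$ for density character and put $\chi(T,\mathcal L)=\sum_{\bar x}\chi(\mathrm{Form}_{\bar x}(T,\mathcal L))$ and $\chi(\mathcal M)=\sup_S\chi(S^{\mathcal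 M})$. The language $\mathcal L$ is separable if $\chi(\emptyset,\mathcal L)=\aleph_0$; a structure $\mathcal M$ is separable if $\chi(\mathcal M)\le\aleph_0$, and compact if all its sorts are compact. A theory $T$ is complete if its models are elementarily equivalent to each other. It is separably categorical if $\chi(T,\mathcal L)\le\aleph_0$ and any two models $\mathcal M,\mathcal N$ of $T$ with $\chi(\mathcal M)=\chi(\mathcal N)=\aleph_0$ are isomorphic. A complete type of $T$ is a function $\mathrm{tp}^{\mathcal M}(\bar a)\colon\varphi\mapsto\varphi^{\mathcal M}(\bar a)$ on the $\mathcal L$-formulas, where $\mathcal M\models T$ and $\bar a$ is a finite tuple in $\mathcal M$. Such a type $p$ is principal (relative to $T$) if its realizations form a $T$-definable set, that is, if some $T$-formula $\varphi$ satisfies $\varphi^{\mathcal M}(\bar a)=d(\bar a,p(\mathcal M))$ for all $\mathcal M\models T$ and all $\bar a\in\mathcal M$, where $p(\mathcal M)$ is the set of realizations of $p$ in $\mathcal M$, tuples carry the maximum metric, and the distance to the empty set is the largest of the bounds $B_S$ of the sorts of $\bar x$. A model $\mathcal M$ of $T$ is atomic if $\mathrm{tp}^{\mathcal M}(\bar a)$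 is principal for every finite tuple $\bar a$ in $\mathcal M$. **Theorem (Ryll-Nardzewski theorem for continuous logic).** 1. Suppose that $\mathcal L$ is separable and that $T$ is an $\mathcal L$-theory with no compact models. Then $T$ is separably categorical if and only if $T$ is complete and every complete type of $T$ is principal. 2. Suppose that $\mathcal L$ has at most countably many sorts (as every separable language does), and let $T$ be a set of $\mathcal L$-sentences. Then any two separable atomic models of $T$ that are elementarily equivalent are isomorphic. In particular, if $T$ is complete, then any two separable atomic models of $T$ are isomorphic. 3. If $T$ is a complete theory in a separable language, then $T$ is separably categorical if and only if all separable models of $T$ are atomic. -/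

import Mathlib

open Set UniformSpace

universe u v w

/-! ## Density character of a topological space -/

/-- The density character: the least cardinality of a dense subset. -/
noncomputable def densityCharacter (X : Type w) [TopologicalSpace X] : Cardinal.{w} :=
  sInf {κ : Cardinal.{w} | ∃ s : Set X, Dense s ∧ Cardinal.mk s = κ}

/-! ## Metric languages -/

/-- A uniform continuity modulus: a continuous increasing function `δ : [0,1] → [0,1]` with
`δ(ε) → 0` as `ε → 0⁺` (for continuous `δ`, this says `δ 0 = 0`). Positivity of `δ ε` for `ε > 0`
is what makes `δ` witness uniform continuity; it is automatic if `δ` is strictly increasing. -/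
structure UCModulus where
  toFun : unitInterval → unitInterval
  continuous : Continuous toFun
  monotone : Monotone toFun
  map_zero : toFun 0 = 0
  pos : ∀ ε, 0 < ε → 0 < toFun ε

/-- A (many-sorted) metric language. The metric symbols `d_S` are not listed among `Rels`; they
are always present, and enter through the constructor `BasicFormula.dist` below. Constant symbols
are function symbols of arity `0`. -/
structure MetricLanguage where
  Sorts : Type u
  sortBound : Sorts → ℝ
  sortBound_pos : ∀ s, 0 < sortBound s
  Funcs : Type u
  funcArity : Funcs → ℕ
  funcDom : ∀ f, Fin (funcArity f) → Sorts
  funcCod : Funcs → Sorts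
  funcMod : Funcs → UCModulus
  Rels : Type u
  relArity : Rels → ℕ
  relDom : ∀ R, Fin (relArity R) → Sorts
  relBound : Rels → ℝ
  relBound_pos : ∀ R, 0 < relBound R
  relMod : Rels → UCModulus

namespace MetricLanguage

/-- An `L`-structure: a family of complete non-empty metric spaces of diameter at most `B_S`,
with uniformly continuous functions and bounded uniformly continuous real-valued relations that
respect the bounds and the moduli of the language. -/
structure MetricStructure (L : MetricLanguage.{u}) where
  carrier : L.Sorts → Type v
  metric : ∀ s, MetricSpace (carrier s)
  complete : ∀ s, CompleteSpace (carrier s)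
  nonempty : ∀ s, Nonempty (carrier s)
  dist_le : ∀ s (a b : carrier s), dist a b ≤ L.sortBound s
  func : ∀ f, (∀ i, carrier (L.funcDom f i)) → carrier (L.funcCod f)
  func_unif : ∀ f (ε : unitInterval), 0 < ε → ∀ a b : (∀ i, carrier (L.funcDom f i)),
    (∀ i, dist (a i) (b i) < (L.funcMod f).toFun ε) → dist (func f a) (func f b) ≤ ε
  rel : ∀ R, (∀ i, carrier (L.relDom R i)) → ℝ
  rel_le : ∀ R a, |rel R a| ≤ L.relBound R
  rel_unif : ∀ R (ε : unitInterval), 0 < ε → ∀ a b : (∀ i, carrier (L.relDom R i)),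
    (∀ i, dist (a i) (b i) < (L.relMod R).toFun ε) → dist (rel R a) (rel R b) ≤ ε

variable {L : MetricLanguage.{u}}

attribute [instance] MetricStructure.metric MetricStructure.complete MetricStructure.nonempty

/-- The finite tuples of `M` sorted by `c`, with the maximum metric. -/
abbrev MetricStructure.Tuple (M : MetricStructure.{u, v} L) {n : ℕ} (c : Fin n → L.Sorts) :
    Type v :=
  ∀ i, M.carrier (c i)

/-- The density character of a structure, the supremum over the sorts. -/
noncomputable def MetricStructure.density (M : MetricStructure.{u, v} L) : Cardinal.{max u v} :=
  ⨆ s : L.Sorts, Cardinal.lift.{u} (densityCharacter (M.carrier s))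

/-- A structure is separable if its density character is at most `ℵ₀`. -/
def MetricStructure.IsSeparable (M : MetricStructure.{u, v} L) : Prop :=
  M.density ≤ Cardinal.aleph0

/-- A structure is compact if all its sorts are. -/
def MetricStructure.IsCompact (M : MetricStructure.{u, v} L) : Prop :=
  ∀ s, CompactSpace (M.carrier s)

/-- An isomorphism: a sorted family of surjective maps that commutes with the functions and
preserves the values of all relations, including the metrics. -/
structure MetricStructure.Iso (M N : MetricStructure.{u, v} L) where
  toFun : ∀ s, M.carrier s → N.carrier s
  map_func : ∀ f (a : M.Tuple (L.funcDom f)),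
    toFun _ (M.func f a) = N.func f (fun i => toFun _ (a i))
  map_rel : ∀ R (a : M.Tuple (L.relDom R)), M.rel R a = N.rel R (fun i => toFun _ (a i))
  map_dist : ∀ s, Isometry (toFun s)
  surjective : ∀ s, Function.Surjective (toFun s)

/-! ## Terms and basic formulas -/

/-- Terms in the free variables `x₀, …, xₙ₋₁`, with `xᵢ` of sort `c i`, indexed by their sort. -/
inductive Term (L : MetricLanguage.{u}) {n : ℕ} (c : Fin n → L.Sorts) : L.Sorts → Type u
  | var (i : Fin n) : Term L c (c i)
  | app (f : L.Funcs) (ts : ∀ i, Term L c (L.funcDom f i)) : Term L c (L.funcCod f)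

/-- Basic formulas whose free variables are among `x₀, …, xₙ₋₁`, with `xᵢ` of sort `c i`.
The quantifiers bind the variable number `0` of the larger variable context `Fin.cons s c`. -/
inductive BasicFormula (L : MetricLanguage.{u}) : {n : ℕ} → (Fin n → L.Sorts) → Type u
  | rel {n : ℕ} {c : Fin n → L.Sorts} (R : L.Rels) (ts : ∀ i, Term L c (L.relDom R i)) :
      BasicFormula L c
  | dist {n : ℕ} {c : Fin n → L.Sorts} {s : L.Sorts} (t₁ t₂ : Term L c s) : BasicFormula L c
  | conn {n : ℕ} {c : Fin n → L.Sorts} {k : ℕ} (f : C(Fin k → ℝ, ℝ))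
      (φ : Fin k → BasicFormula L c) : BasicFormula L c
  | sup {n : ℕ} {c : Fin n → L.Sorts} (s : L.Sorts)
      (φ : BasicFormula L (Fin.cons s c : Fin (n + 1) → L.Sorts)) : BasicFormula L c
  | inf {n : ℕ} {c : Fin n → L.Sorts} (s : L.Sorts)
      (φ : BasicFormula L (Fin.cons s c : Fin (n + 1) → L.Sorts)) : BasicFormula L c

/-- The tuple `(b, a₀, …, aₙ₋₁)`. -/
def MetricStructure.consTuple (M : MetricStructure.{u, v} L) {n : ℕ} {c : Fin n → L.Sorts}
    {s : L.Sorts} (b : M.carrier s) (a : M.Tuple c) :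
    M.Tuple (Fin.cons s c : Fin (n + 1) → L.Sorts) :=
  Fin.cons (α := fun i => M.carrier ((Fin.cons s c : Fin (n + 1) → L.Sorts) i)) b a

/-- The interpretation of a term. -/
def Term.eval (M : MetricStructure.{u, v} L) {n : ℕ} {c : Fin n → L.Sorts} (a : M.Tuple c) :
    {s : L.Sorts} → Term L c s → M.carrier s
  | _, .var i => a i
  | _, .app f ts => M.func f (fun i => (ts i).eval M a)

/-- The interpretation of a basic formula. -/
noncomputable def BasicFormula.eval (M : MetricStructure.{u, v} L) :
    {n : ℕ} → {c : Fin n → L.Sorts} → BasicFormula L c → M.Tuple c → ℝ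
  | _, _, .rel R ts, a => M.rel R (fun i => (ts i).eval M a)
  | _, _, .dist t₁ t₂, a => Dist.dist (t₁.eval M a) (t₂.eval M a)
  | _, _, .conn f φ, a => f (fun i => (φ i).eval M a)
  | _, _, .sup s φ, a => ⨆ b : M.carrier s, φ.eval M (M.consTuple b a)
  | _, _, .inf s φ, a => ⨅ b : M.carrier s, φ.eval M (M.consTuple b a)

/-- Basic formulas are bounded, uniformly in all structures. -/
theorem BasicFormula.exists_bound {n : ℕ} {c : Fin n → L.Sorts} (φ : BasicFormula L c) :
    ∃ B : ℝ, ∀ (M : MetricStructure.{u, v} L) (a : M.Tuple c), |φ.eval M a| ≤ B := by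
  induction φ with
  | rel R ts => exact ⟨L.relBound R, fun M a => M.rel_le R _⟩
  | @dist n c s t₁ t₂ =>
    refine ⟨L.sortBound s, fun M a => ?_⟩
    rw [BasicFormula.eval, abs_of_nonneg dist_nonneg]
    exact M.dist_le s _ _
  | @conn n c k f φ ih =>
    choose B hB using ih
    have hK : IsCompact (Set.pi univ fun i : Fin k => Icc (-B i) (B i)) :=
      isCompact_univ_pi fun i => isCompact_Icc
    obtain ⟨C, hC⟩ := hK.exists_bound_of_continuousOn f.continuous.continuousOn
    refine ⟨C, fun M a => ?_⟩
    rw [BasicFormula.eval, ← Real.norm_eq_abs]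
    exact hC _ fun i _ => abs_le.1 (hB i M a)
  | sup s φ ih =>
    obtain ⟨B, hB⟩ := ih
    refine ⟨B, fun M a => ?_⟩
    rw [BasicFormula.eval, abs_le]
    have hbdd : BddAbove (range fun b : M.carrier s => φ.eval M (M.consTuple b a)) :=
      ⟨B, by rintro _ ⟨b, rfl⟩; exact (abs_le.1 (hB M _)).2⟩
    obtain ⟨b₀⟩ := M.nonempty s
    exact ⟨(abs_le.1 (hB M _)).1.trans (le_ciSup hbdd b₀),
      ciSup_le fun b => (abs_le.1 (hB M _)).2⟩
  | inf s φ ih =>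
    obtain ⟨B, hB⟩ := ih
    refine ⟨B, fun M a => ?_⟩
    rw [BasicFormula.eval, abs_le]
    have hbdd : BddBelow (range fun b : M.carrier s => φ.eval M (M.consTuple b a)) :=
      ⟨-B, by rintro _ ⟨b, rfl⟩; exact (abs_le.1 (hB M _)).1⟩
    obtain ⟨b₀⟩ := M.nonempty s
    exact ⟨le_ciInf fun b => (abs_le.1 (hB M _)).1,
      (ciInf_le hbdd b₀).trans (abs_le.1 (hB M _)).2⟩

/-! ## General formulas

For a class `K` of structures, `Form K c` is the completion of the space of basic formulas for the
seminorm `sup {|φ^M(a)| : M ∈ K, a ∈ M}`. -/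

/-- The basic formulas in the variables `c`, seen as a space with the pseudometric given by `K`. -/
def BasicForm (_K : Set (MetricStructure.{u, v} L)) {n : ℕ} (c : Fin n → L.Sorts) : Type u :=
  BasicFormula L c

/-- The values `|φ^M(a) - ψ^M(a)|` for `M ∈ K` and `a ∈ M`. -/
def gapSet (K : Set (MetricStructure.{u, v} L)) {n : ℕ} {c : Fin n → L.Sorts}
    (φ ψ : BasicFormula L c) : Set ℝ :=
  {r | ∃ M ∈ K, ∃ a : M.Tuple c, r = |φ.eval M a - ψ.eval M a|}

theorem bddAbove_gapSet (K : Set (MetricStructure.{u, v} L)) {n : ℕ} {c : Fin n → L.Sorts}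
    (φ ψ : BasicFormula L c) : BddAbove (gapSet K φ ψ) := by
  obtain ⟨B, hB⟩ := BasicFormula.exists_bound.{u, v} φ
  obtain ⟨C, hC⟩ := BasicFormula.exists_bound.{u, v} ψ
  refine ⟨B + C, ?_⟩
  rintro _ ⟨M, -, a, rfl⟩
  exact (abs_sub _ _).trans (add_le_add (hB M a) (hC M a))

theorem le_sSup_gapSet {K : Set (MetricStructure.{u, v} L)} {n : ℕ} {c : Fin n → L.Sorts}
    (φ ψ : BasicFormula L c) {M : MetricStructure.{u, v} L} (hM : M ∈ K) (a : M.Tuple c) :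
    |φ.eval M a - ψ.eval M a| ≤ sSup (gapSet K φ ψ) :=
  le_csSup (bddAbove_gapSet K φ ψ) ⟨M, hM, a, rfl⟩

theorem sSup_gapSet_nonneg (K : Set (MetricStructure.{u, v} L)) {n : ℕ} {c : Fin n → L.Sorts}
    (φ ψ : BasicFormula L c) : 0 ≤ sSup (gapSet K φ ψ) :=
  Real.sSup_nonneg (by rintro _ ⟨M, -, a, rfl⟩; exact abs_nonneg _)

noncomputable instance (K : Set (MetricStructure.{u, v} L)) {n : ℕ} (c : Fin n → L.Sorts) :
    PseudoMetricSpace (BasicForm K c) where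
  dist φ ψ := sSup (gapSet K φ ψ)
  dist_self φ := le_antisymm
    (Real.sSup_le (by rintro _ ⟨M, -, a, rfl⟩; simp) le_rfl) (sSup_gapSet_nonneg K φ φ)
  dist_comm φ ψ := by
    congr 1
    ext r
    simp only [gapSet, mem_ofPred_eq, abs_sub_comm]
  dist_triangle φ ψ χ := by
    refine Real.sSup_le ?_ (add_nonneg (sSup_gapSet_nonneg K φ ψ) (sSup_gapSet_nonneg K ψ χ))
    rintro _ ⟨M, hM, a, rfl⟩
    exact (abs_sub_le _ _ _).trans
      (add_le_add (le_sSup_gapSet φ ψ hM a) (le_sSup_gapSet ψ χ hM a))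

/-- General formulas relative to `K` in the variables `c`: limits of basic formulas. -/
abbrev Form (K : Set (MetricStructure.{u, v} L)) {n : ℕ} (c : Fin n → L.Sorts) : Type u :=
  Completion (BasicForm K c)

/-- The interpretation of a general formula in a structure `M ∈ K`: the limit of the
interpretations of the basic formulas that approximate it. -/
noncomputable def Form.eval {K : Set (MetricStructure.{u, v} L)} {n : ℕ} {c : Fin n → L.Sorts}
    (M : K) (a : M.1.Tuple c) : Form K c → ℝ :=
  Completion.extension fun φ : BasicForm K c => BasicFormula.eval M.1 φ a

theorem uniformContinuous_eval {K : Set (MetricStructure.{u, v} L)} {n : ℕ}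
    {c : Fin n → L.Sorts} (M : K) (a : M.1.Tuple c) :
    UniformContinuous fun φ : BasicForm K c => BasicFormula.eval M.1 φ a :=
  (LipschitzWith.of_dist_le_mul (K := 1) fun φ ψ => by
    rw [NNReal.coe_one, one_mul, Real.dist_eq]
    exact le_sSup_gapSet φ ψ M.2 a).uniformContinuous

theorem Form.eval_coe {K : Set (MetricStructure.{u, v} L)} {n : ℕ} {c : Fin n → L.Sorts}
    (M : K) (a : M.1.Tuple c) (φ : BasicForm K c) :
    Form.eval M a (φ : Form K c) = BasicFormula.eval M.1 φ a :=
  Completion.extension_coe (uniformContinuous_eval M a) φ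

/-- `L`-formulas: general formulas relative to the class of all structures. -/
abbrev LFormula (L : MetricLanguage.{u}) {n : ℕ} (c : Fin n → L.Sorts) : Type u :=
  Form (univ : Set (MetricStructure.{u, v} L)) c

/-- `L`-sentences: `L`-formulas without free variables. -/
abbrev Sentence (L : MetricLanguage.{u}) : Type u :=
  LFormula.{u, v} L (Fin.elim0 : Fin 0 → L.Sorts)

/-- The type of a tuple `a` in `M`, the function `φ ↦ φ^M(a)` on the `L`-formulas. -/
noncomputable def MetricStructure.tp (M : MetricStructure.{u, v} L) {n : ℕ}
    {c : Fin n → L.Sorts} (a : M.Tuple c) : LFormula.{u, v} L c → ℝ :=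
  Form.eval (⟨M, mem_univ M⟩ : (univ : Set (MetricStructure.{u, v} L))) a

/-- The value of a sentence in a structure. -/
noncomputable def MetricStructure.value (M : MetricStructure.{u, v} L)
    (φ : Sentence.{u, v} L) : ℝ :=
  M.tp (fun i : Fin 0 => i.elim0) φ

/-- Elementary equivalence: the same sentences take the value `0`. -/
def MetricStructure.ElemEquiv (M N : MetricStructure.{u, v} L) : Prop :=
  {φ : Sentence.{u, v} L | M.value φ = 0} = {φ : Sentence.{u, v} L | N.value φ = 0}

/-! ## Theories -/

/-- The models of a set of sentences. -/
def Mod (T : Set (Sentence.{u, v} L)) : Set (MetricStructure.{u, v} L) :=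
  {M | ∀ φ ∈ T, M.value φ = 0}

/-- A theory is a satisfiable set of sentences. -/
def IsTheory (T : Set (Sentence.{u, v} L)) : Prop :=
  (Mod T).Nonempty

/-- A set of sentences is complete if it is satisfiable and all its models are elementarily
equivalent. -/
def IsCompleteTheory (T : Set (Sentence.{u, v} L)) : Prop :=
  (Mod T).Nonempty ∧ ∀ M ∈ Mod T, ∀ N ∈ Mod T, M.ElemEquiv N

/-- `T`-formulas. -/
abbrev TFormula (T : Set (Sentence.{u, v} L)) {n : ℕ} (c : Fin n → L.Sorts) : Type u :=
  Form (Mod T) c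

/-- The density character of the language relative to `T`: the sum, over all finite variable
contexts, of the density characters of the spaces of `T`-formulas. -/
noncomputable def languageDensity (T : Set (Sentence.{u, v} L)) : Cardinal.{u} :=
  Cardinal.sum fun c : (Σ n : ℕ, Fin n → L.Sorts) => densityCharacter (TFormula T c.2)

/-- A language is separable if its density character (relative to the empty theory) is `ℵ₀`. -/
def IsSeparable (L : MetricLanguage.{u}) : Prop :=
  languageDensity (∅ : Set (Sentence.{u, v} L)) = Cardinal.aleph0

/-- `κ`-categoricity. -/
def IsCategorical (T : Set (Sentence.{u, v} L)) (κ : Cardinal.{max u v}) : Prop :=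
  Cardinal.lift.{v} (languageDensity T) ≤ κ ∧
    ∀ M ∈ Mod T, ∀ N ∈ Mod T, M.density = κ → N.density = κ → Nonempty (M.Iso N)

/-- Separable categoricity is `ℵ₀`-categoricity. -/
def IsSeparablyCategorical (T : Set (Sentence.{u, v} L)) : Prop :=
  IsCategorical T Cardinal.aleph0

/-! ## Types, definable sets, principal types -/

/-- The space of complete types of `T` in the variables `c`. -/
def TypeSpace (T : Set (Sentence.{u, v} L)) {n : ℕ} (c : Fin n → L.Sorts) :
    Set (LFormula.{u, v} L c → ℝ) :=
  {p | ∃ M ∈ Mod T, ∃ a : M.Tuple c, M.tp a = p}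

open Classical in
/-- The distance from a tuple to a set of tuples; the distance to the empty set is, by convention,
the largest of the bounds on the metrics of the sorts involved. -/
noncomputable def MetricStructure.distTo (M : MetricStructure.{u, v} L) {n : ℕ}
    {c : Fin n → L.Sorts} (a : M.Tuple c) (X : Set (M.Tuple c)) : ℝ :=
  if X.Nonempty then Metric.infDist a X else ⨆ i, L.sortBound (c i)

/-- A family `X(M) ⊆ M^c`, for `M` a model of `T`, is `T`-definable if the distance to `X(M)` is
given by a `T`-formula. -/
def IsTDefinable (T : Set (Sentence.{u, v} L)) {n : ℕ} (c : Fin n → L.Sorts)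
    (X : ∀ M : Mod T, Set (M.1.Tuple c)) : Prop :=
  ∃ φ : TFormula T c, ∀ (M : Mod T) (a : M.1.Tuple c), Form.eval M a φ = M.1.distTo a (X M)

/-- The set of realizations of `p` in `M`. It is closed, and elementary embeddings map
realizations to realizations, so this is a functor on the models of `T`. -/
def MetricStructure.realizations (M : MetricStructure.{u, v} L) {n : ℕ} {c : Fin n → L.Sorts}
    (p : LFormula.{u, v} L c → ℝ) : Set (M.Tuple c) :=
  {a | M.tp a = p}

/-- A type is principal relative to `T` if its set of realizations is `T`-definable. -/
def IsPrincipal (T : Set (Sentence.{u, v} L)) {n : ℕ} {c : Fin n → L.Sorts}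
    (p : LFormula.{u, v} L c → ℝ) : Prop :=
  IsTDefinable T c fun M => M.1.realizations p

/-- A model of `T` is atomic if the types of all its finite tuples are principal. -/
def IsAtomicModel (T : Set (Sentence.{u, v} L)) (M : MetricStructure.{u, v} L) : Prop :=
  M ∈ Mod T ∧ ∀ {n : ℕ} (c : Fin n → L.Sorts) (a : M.Tuple c), IsPrincipal T (M.tp a)

end MetricLanguage

set_option autoImplicit false

namespace MetricLanguage

variable {L : MetricLanguage.{u}}

/-! ## Uniform continuity of terms and formulas -/

/-! Two constructions carry the theorem.

Back-and-forth. In an atomic model the type p of a tuple (a, y) is principal, so the distance to p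
is given by a formula D, and inf_y D(x, y) vanishes at x = a. If b has the same type as a in another
model, the infimum vanishes at b as well. Because D is a true distance, a tuple at which D is small
has a genuine realization of p close to it. So equality of types extends by one coordinate, at the
price of a small move of the earlier ones (`MetricStructure.InitialTypeEq.exists_extension`). With
summable errors, alternating between dense sequences of two separable atomic models gives in the
limit dense families of the same type, hence an isomorphism
(`MetricStructure.nonempty_iso_of_isAtomicModel`).

Omitting types. Call p isolated if every metric neighbourhood of p contains an open condition φ < 0
that is true of p. An isolated type is principal, because successive approximation turns φ < 0 into
a nearby realization (`MetricStructure.IsIsolated.isPrincipal`). If p is not isolated, every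
satisfiable open condition can be refined so that a given tuple of variables stays away from p
(`MetricStructure.exists_avoiding`). Countably many requirements of this kind, together with
requirements that provide Tarski–Vaught witnesses, are met by a decreasing sequence of conditions,
each satisfied by a family in one fixed model; the ultrapower contains a single family that meets
them all. The closure of that family is a separable model that omits p
(`IsSeparable.exists_omitting`). Hence, if the separable models of a complete theory are isomorphic,
they realize only principal types.

Categoricity only speaks of models of density exactly ℵ₀. Separable non-compact models have this
density, and a compact model is determined up to isomorphism by its theory. Downward
Löwenheim–Skolem yields completeness in the absence of compact models, and moves every type into a
separable model.

Formulas are mostly handled as functions of families with an arbitrary index set (`IsFormulaFun`),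
since the families that matter are infinite although each formula sees finitely many members. -/

theorem exists_pos_le_of_finite {ι : Type*} [Finite ι] {δ : ι → ℝ} (hδ : ∀ i, 0 < δ i) :
    ∃ d > 0, ∀ i, d ≤ δ i := by
  rcases isEmpty_or_nonempty ι with h | h
  · exact ⟨1, one_pos, fun i => h.elim i⟩
  · obtain ⟨i, hi⟩ := Finite.exists_min δ
    exact ⟨δ i, hδ i, hi⟩

theorem exists_unitInterval_le {ε : ℝ} (hε : 0 < ε) : ∃ η : unitInterval, 0 < η ∧ (η : ℝ) ≤ ε :=
  ⟨⟨min ε 1, (lt_min hε one_pos).le, min_le_right _ _⟩, lt_min hε one_pos, min_le_left _ _⟩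

theorem MetricStructure.func_uniform (f : L.Funcs) {ε : ℝ} (hε : 0 < ε) :
    ∃ δ > 0, ∀ (M : MetricStructure.{u, v} L) (a b : M.Tuple (L.funcDom f)),
      (∀ i, dist (a i) (b i) < δ) → dist (M.func f a) (M.func f b) ≤ ε := by
  obtain ⟨η, h0, h1⟩ := exists_unitInterval_le hε
  exact ⟨_, (L.funcMod f).pos η h0, fun M a b h => (M.func_unif f η h0 a b h).trans h1⟩

theorem MetricStructure.rel_uniform (R : L.Rels) {ε : ℝ} (hε : 0 < ε) :
    ∃ δ > 0, ∀ (M : MetricStructure.{u, v} L) (a b : M.Tuple (L.relDom R)),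
      (∀ i, dist (a i) (b i) < δ) → |M.rel R a - M.rel R b| ≤ ε := by
  obtain ⟨η, h0, h1⟩ := exists_unitInterval_le hε
  exact ⟨_, (L.relMod R).pos η h0, fun M a b h => (M.rel_unif R η h0 a b h).trans h1⟩

theorem Term.eval_uniform {n : ℕ} {c : Fin n → L.Sorts} {s : L.Sorts} (t : Term L c s) :
    ∀ ε > 0, ∃ δ > 0, ∀ (M : MetricStructure.{u, v} L) (a b : M.Tuple c),
      (∀ i, dist (a i) (b i) < δ) → dist (t.eval M a) (t.eval M b) ≤ ε := by
  induction t with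
  | var i => exact fun ε hε => ⟨ε, hε, fun M a b h => (h i).le⟩
  | app f ts ih =>
    intro ε hε
    obtain ⟨δ, hδ, h⟩ := MetricStructure.func_uniform.{u, v} f hε
    choose η hη h' using fun i => ih i (δ / 2) (half_pos hδ)
    obtain ⟨d, hd, hd'⟩ := exists_pos_le_of_finite hη
    exact ⟨d, hd, fun M a b hab => h M _ _ fun i =>
      (h' i M a b fun j => (hab j).trans_le (hd' i)).trans_lt (half_lt_self hδ)⟩

theorem abs_ciSup_sub_ciSup_le {ι : Type*} [Nonempty ι] {f g : ι → ℝ} {ε : ℝ}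
    (hf : BddAbove (range f)) (hg : BddAbove (range g)) (h : ∀ i, |f i - g i| ≤ ε) :
    |(⨆ i, f i) - ⨆ i, g i| ≤ ε := by
  rw [abs_le]
  constructor
  · have : ⨆ i, g i ≤ (⨆ i, f i) + ε :=
      ciSup_le fun i => by linarith [le_ciSup hf i, (abs_le.1 (h i)).1]
    linarith
  · have : ⨆ i, f i ≤ (⨆ i, g i) + ε :=
      ciSup_le fun i => by linarith [le_ciSup hg i, (abs_le.1 (h i)).2]
    linarith

theorem abs_ciInf_sub_ciInf_le {ι : Type*} [Nonempty ι] {f g : ι → ℝ} {ε : ℝ}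
    (hf : BddBelow (range f)) (hg : BddBelow (range g)) (h : ∀ i, |f i - g i| ≤ ε) :
    |(⨅ i, f i) - ⨅ i, g i| ≤ ε := by
  rw [abs_le]
  constructor
  · have : (⨅ i, g i) - ε ≤ ⨅ i, f i :=
      le_ciInf fun i => by linarith [ciInf_le hg i, (abs_le.1 (h i)).1]
    linarith
  · have : (⨅ i, f i) - ε ≤ ⨅ i, g i :=
      le_ciInf fun i => by linarith [ciInf_le hf i, (abs_le.1 (h i)).2]
    linarith

theorem BasicFormula.bddAbove_range {n : ℕ} {c : Fin n → L.Sorts} (φ : BasicFormula L c)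
    (M : MetricStructure.{u, v} L) {ι : Type*} (a : ι → M.Tuple c) :
    BddAbove (range fun i => φ.eval M (a i)) := by
  obtain ⟨B, hB⟩ := BasicFormula.exists_bound.{u, v} φ
  exact ⟨B, by rintro _ ⟨i, rfl⟩; exact (abs_le.1 (hB M _)).2⟩

theorem BasicFormula.bddBelow_range {n : ℕ} {c : Fin n → L.Sorts} (φ : BasicFormula L c)
    (M : MetricStructure.{u, v} L) {ι : Type*} (a : ι → M.Tuple c) :
    BddBelow (range fun i => φ.eval M (a i)) := by
  obtain ⟨B, hB⟩ := BasicFormula.exists_bound.{u, v} φ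
  exact ⟨-B, by rintro _ ⟨i, rfl⟩; exact (abs_le.1 (hB M _)).1⟩

theorem BasicFormula.eval_inf_lt {n : ℕ} {c : Fin n → L.Sorts} {s : L.Sorts}
    (φ : BasicFormula L (Fin.cons s c : Fin (n + 1) → L.Sorts)) (M : MetricStructure.{u, v} L)
    (a : M.Tuple c) (r : ℝ) :
    (BasicFormula.inf s φ).eval M a < r ↔ ∃ b, φ.eval M (M.consTuple b a) < r :=
  ciInf_lt_iff (φ.bddBelow_range M _)

theorem BasicFormula.lt_eval_sup {n : ℕ} {c : Fin n → L.Sorts} {s : L.Sorts}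
    (φ : BasicFormula L (Fin.cons s c : Fin (n + 1) → L.Sorts)) (M : MetricStructure.{u, v} L)
    (a : M.Tuple c) (r : ℝ) :
    r < (BasicFormula.sup s φ).eval M a ↔ ∃ b, r < φ.eval M (M.consTuple b a) :=
  lt_ciSup_iff (φ.bddAbove_range M _)

theorem MetricStructure.dist_consTuple_lt (M : MetricStructure.{u, v} L) {n : ℕ}
    {c : Fin n → L.Sorts} {s : L.Sorts} {b b' : M.carrier s} {a a' : M.Tuple c} {δ : ℝ}
    (hb : dist b b' < δ) (ha : ∀ i, dist (a i) (a' i) < δ) (i : Fin (n + 1)) :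
    dist (M.consTuple b a i) (M.consTuple b' a' i) < δ := by
  induction i using Fin.cases with
  | zero => exact hb
  | succ i => exact ha i

/-- The modulus depends on the formula only. A connective is uniformly continuous on the compact box
that contains all values of its arguments, and a common modulus passes through suprema and infima.
Halving δ in the proof turns the non-strict bounds of the induction into the strict ones that are
needed next. -/
theorem BasicFormula.eval_uniform {n : ℕ} {c : Fin n → L.Sorts} (φ : BasicFormula L c) :
    ∀ ε > 0, ∃ δ > 0, ∀ (M : MetricStructure.{u, v} L) (a b : M.Tuple c),
      (∀ i, Dist.dist (a i) (b i) < δ) → |φ.eval M a - φ.eval M b| ≤ ε := by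
  induction φ with
  | rel R ts =>
    intro ε hε
    obtain ⟨δ, hδ, h⟩ := MetricStructure.rel_uniform.{u, v} R hε
    choose η hη h' using fun i => (ts i).eval_uniform (δ / 2) (half_pos hδ)
    obtain ⟨d, hd, hd'⟩ := exists_pos_le_of_finite hη
    exact ⟨d, hd, fun M a b hab => h M _ _ fun i =>
      (h' i M a b fun j => (hab j).trans_le (hd' i)).trans_lt (half_lt_self hδ)⟩
  | dist t₁ t₂ =>
    intro ε hε
    obtain ⟨δ₁, h₁, h₁'⟩ := t₁.eval_uniform (ε / 2) (half_pos hε)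
    obtain ⟨δ₂, h₂, h₂'⟩ := t₂.eval_uniform (ε / 2) (half_pos hε)
    refine ⟨min δ₁ δ₂, lt_min h₁ h₂, fun M a b hab => ?_⟩
    have e₁ := h₁' M a b fun i => (hab i).trans_le (min_le_left _ _)
    have e₂ := h₂' M a b fun i => (hab i).trans_le (min_le_right _ _)
    simp only [BasicFormula.eval]
    rw [← Real.dist_eq]
    exact (dist_dist_dist_le _ _ _ _).trans (by linarith)
  | @conn n c k f φ ih =>
    intro ε hε
    choose B hB using fun i => BasicFormula.exists_bound.{u, v} (φ i)
    have hK : IsCompact (Set.pi univ fun i : Fin k => Icc (-B i) (B i)) :=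
      isCompact_univ_pi fun i => isCompact_Icc
    have hu := hK.uniformContinuousOn_of_continuous f.continuous.continuousOn
    obtain ⟨δ, hδ, h⟩ := Metric.uniformContinuousOn_iff.1 hu ε hε
    choose η hη h' using fun i => ih i (δ / 2) (half_pos hδ)
    obtain ⟨d, hd, hd'⟩ := exists_pos_le_of_finite hη
    refine ⟨d, hd, fun M a b hab => ?_⟩
    refine (h _ (fun i _ => abs_le.1 (hB i M a)) _ (fun i _ => abs_le.1 (hB i M b)) ?_).le
    rw [dist_pi_lt_iff hδ]
    exact fun i => (h' i M a b fun j => (hab j).trans_le (hd' i)).trans_lt (half_lt_self hδ)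
  | sup s φ ih =>
    intro ε hε
    obtain ⟨δ, hδ, h⟩ := ih ε hε
    refine ⟨δ, hδ, fun M a b hab => ?_⟩
    exact abs_ciSup_sub_ciSup_le (φ.bddAbove_range M _) (φ.bddAbove_range M _) fun x =>
      h M _ _ (M.dist_consTuple_lt ((dist_self x).trans_lt hδ) hab)
  | inf s φ ih =>
    intro ε hε
    obtain ⟨δ, hδ, h⟩ := ih ε hε
    refine ⟨δ, hδ, fun M a b hab => ?_⟩
    exact abs_ciInf_sub_ciInf_le (φ.bddBelow_range M _) (φ.bddBelow_range M _) fun x =>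
      h M _ _ (M.dist_consTuple_lt ((dist_self x).trans_lt hδ) hab)

theorem BasicFormula.continuous_eval {n : ℕ} {c : Fin n → L.Sorts} (φ : BasicFormula L c)
    (M : MetricStructure.{u, v} L) : Continuous fun a : M.Tuple c => φ.eval M a := by
  rw [Metric.continuous_iff]
  intro b ε hε
  obtain ⟨δ, hδ, h⟩ := BasicFormula.eval_uniform.{u, v} φ (ε / 2) (half_pos hε)
  exact ⟨δ, hδ, fun a hab => (h M a b ((dist_pi_lt_iff hδ).1 hab)).trans_lt (half_lt_self hε)⟩

/-! ## Substitution -/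

/-- Substitution of terms for the variables of a term. -/
def Term.subst {n m : ℕ} {c : Fin n → L.Sorts} {c' : Fin m → L.Sorts}
    (t : ∀ i, Term L c' (c i)) : {s : L.Sorts} → Term L c s → Term L c' s
  | _, .var i => t i
  | _, .app f ts => .app f fun i => (ts i).subst t

theorem Term.eval_subst (M : MetricStructure.{u, v} L) {n m : ℕ} {c : Fin n → L.Sorts}
    {c' : Fin m → L.Sorts} (t : ∀ i, Term L c' (c i)) (a : M.Tuple c') {s : L.Sorts}
    (u : Term L c s) : (u.subst t).eval M a = u.eval M fun i => (t i).eval M a := by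
  induction u with
  | var i => rfl
  | app f ts ih => simp only [Term.subst, Term.eval, ih]

/-- A term with an additional variable number `0`. -/
def Term.lift {n : ℕ} {c : Fin n → L.Sorts} (s₀ : L.Sorts) {s : L.Sorts} (t : Term L c s) :
    Term L (Fin.cons s₀ c : Fin (n + 1) → L.Sorts) s :=
  t.subst fun i => Term.var (c := (Fin.cons s₀ c : Fin (n + 1) → L.Sorts)) i.succ

theorem Term.eval_lift (M : MetricStructure.{u, v} L) {n : ℕ} {c : Fin n → L.Sorts}
    {s₀ s : L.Sorts} (t : Term L c s) (b : M.carrier s₀) (a : M.Tuple c) :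
    (t.lift s₀).eval M (M.consTuple b a) = t.eval M a :=
  Term.eval_subst M _ _ t

/-- The substitution under a quantifier. -/
def Term.liftSubst {n m : ℕ} {c : Fin n → L.Sorts} {c' : Fin m → L.Sorts} (s₀ : L.Sorts)
    (t : ∀ i, Term L c' (c i)) (i : Fin (n + 1)) :
    Term L (Fin.cons s₀ c' : Fin (m + 1) → L.Sorts)
      ((Fin.cons s₀ c : Fin (n + 1) → L.Sorts) i) :=
  Fin.cases (motive := fun i => Term L (Fin.cons s₀ c' : Fin (m + 1) → L.Sorts)
      ((Fin.cons s₀ c : Fin (n + 1) → L.Sorts) i))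
    (Term.var (c := (Fin.cons s₀ c' : Fin (m + 1) → L.Sorts)) 0) (fun i => (t i).lift s₀) i

theorem Term.eval_liftSubst (M : MetricStructure.{u, v} L) {n m : ℕ} {c : Fin n → L.Sorts}
    {c' : Fin m → L.Sorts} {s₀ : L.Sorts} (t : ∀ i, Term L c' (c i)) (b : M.carrier s₀)
    (a : M.Tuple c') :
    (fun i => (Term.liftSubst s₀ t i).eval M (M.consTuple b a)) =
      M.consTuple b fun i => (t i).eval M a := by
  funext i
  induction i using Fin.cases with
  | zero => rfl
  | succ i => exact Term.eval_lift M (t i) b a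

/-- Substitution of terms for the free variables of a formula. -/
def BasicFormula.subst : {n : ℕ} → {c : Fin n → L.Sorts} → BasicFormula L c → {m : ℕ} →
    {c' : Fin m → L.Sorts} → (∀ i, Term L c' (c i)) → BasicFormula L c'
  | _, _, .rel R ts, _, _, t => .rel R fun i => (ts i).subst t
  | _, _, .dist t₁ t₂, _, _, t => .dist (t₁.subst t) (t₂.subst t)
  | _, _, .conn f φ, _, _, t => .conn f fun i => (φ i).subst t
  | _, _, .sup s φ, _, _, t => .sup s (φ.subst (Term.liftSubst s t))
  | _, _, .inf s φ, _, _, t => .inf s (φ.subst (Term.liftSubst s t))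

theorem BasicFormula.eval_subst (M : MetricStructure.{u, v} L) {n : ℕ} {c : Fin n → L.Sorts}
    (φ : BasicFormula L c) : ∀ {m : ℕ} {c' : Fin m → L.Sorts} (t : ∀ i, Term L c' (c i))
    (a : M.Tuple c'), (φ.subst t).eval M a = φ.eval M fun i => (t i).eval M a := by
  induction φ with
  | rel R ts => intro m c' t a; simp only [BasicFormula.subst, BasicFormula.eval, Term.eval_subst]
  | dist t₁ t₂ =>
    intro m c' t a; simp only [BasicFormula.subst, BasicFormula.eval, Term.eval_subst]
  | conn f φ ih => intro m c' t a; simp only [BasicFormula.subst, BasicFormula.eval, ih]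
  | sup s φ ih =>
    intro m c' t a
    simp only [BasicFormula.subst, BasicFormula.eval, ih, Term.eval_liftSubst]
  | inf s φ ih =>
    intro m c' t a
    simp only [BasicFormula.subst, BasicFormula.eval, ih, Term.eval_liftSubst]

/-! ## Uniformly definable functions of arbitrary families -/

section Definable

variable {I : Type*} {J : Type*}

/-- `u` is given, in all structures, by a term in finitely many of the variables of sorts `σ`. -/
def IsTermFun (σ : I → L.Sorts) (s : L.Sorts)
    (u : ∀ M : MetricStructure.{u, v} L, (∀ i, M.carrier (σ i)) → M.carrier s) : Prop :=
  ∃ (n : ℕ) (e : Fin n → I) (t : Term L (fun k => σ (e k)) s),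
    ∀ M A, u M A = t.eval M fun k => A (e k)

/-- `F` is given, in all structures, by a basic formula in finitely many of the variables of
sorts `σ`. -/
def IsFormulaFun (σ : I → L.Sorts)
    (F : ∀ M : MetricStructure.{u, v} L, (∀ i, M.carrier (σ i)) → ℝ) : Prop :=
  ∃ (n : ℕ) (e : Fin n → I) (φ : BasicFormula L fun k => σ (e k)),
    ∀ M A, F M A = φ.eval M fun k => A (e k)

theorem BasicFormula.isFormulaFun {n : ℕ} {c : Fin n → L.Sorts} (φ : BasicFormula L c) :
    IsFormulaFun.{u, v} c fun M a => φ.eval M a :=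
  ⟨n, id, φ, fun _ _ => rfl⟩

theorem IsTermFun.var (σ : I → L.Sorts) (i : I) : IsTermFun.{u, v} σ (σ i) fun _ A => A i :=
  ⟨1, fun _ => i, Term.var (c := fun _ : Fin 1 => σ i) 0, fun _ _ => rfl⟩

theorem IsTermFun.cast (σ : I → L.Sorts) {i : I} {s : L.Sorts} (h : σ i = s) :
    IsTermFun.{u, v} σ s fun _ A => h ▸ A i := by
  subst h
  exact .var σ i

theorem Term.exists_of_range_subset {σ : I → L.Sorts} {n m : ℕ} {e : Fin n → I} {e' : Fin m → I}
    (h : range e ⊆ range e') (k : Fin n) :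
    ∃ t : Term L (fun k => σ (e' k)) (σ (e k)), ∀ (M : MetricStructure.{u, v} L)
      (A : ∀ i, M.carrier (σ i)), t.eval M (fun k => A (e' k)) = A (e k) := by
  obtain ⟨j, hj⟩ := h ⟨k, rfl⟩
  rw [← hj]
  exact ⟨.var j, fun _ _ => rfl⟩

theorem exists_fin_range_supset {ι : Type*} [Finite ι] {n : ι → ℕ} (e : ∀ i, Fin (n i) → I) :
    ∃ (m : ℕ) (e' : Fin m → I), ∀ i, range (e i) ⊆ range e' := by
  have hf : (⋃ i, range (e i)).Finite := finite_iUnion fun i => finite_range _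
  obtain ⟨m, f, -, hf'⟩ := hf.fin_param
  exact ⟨m, f, fun i => by rw [hf']; exact subset_iUnion (fun i => range (e i)) i⟩

theorem IsTermFun.subst_of_range_subset {σ : I → L.Sorts} {s : L.Sorts} {n m : ℕ}
    {e : Fin n → I} {e' : Fin m → I} (h : range e ⊆ range e')
    (t : Term L (fun k => σ (e k)) s) :
    ∃ t' : Term L (fun k => σ (e' k)) s, ∀ (M : MetricStructure.{u, v} L)
      (A : ∀ i, M.carrier (σ i)), t'.eval M (fun k => A (e' k)) = t.eval M fun k => A (e k) := by
  choose f hf using Term.exists_of_range_subset.{u, v} (σ := σ) h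
  exact ⟨t.subst f, fun M A => by rw [Term.eval_subst]; simp only [hf]⟩

/-- Finitely many terms together use finitely many variables, so re-indexing puts all of them into
one finite context. -/
theorem IsTermFun.exists_common {ι : Type*} [Finite ι] {σ : I → L.Sorts} {s : ι → L.Sorts}
    {u : ∀ i, ∀ M : MetricStructure.{u, v} L, (∀ i, M.carrier (σ i)) → M.carrier (s i)}
    (hu : ∀ i, IsTermFun σ (s i) (u i)) :
    ∃ (n : ℕ) (e : Fin n → I) (t : ∀ i, Term L (fun k => σ (e k)) (s i)),
      ∀ i M A, u i M A = (t i).eval M fun k => A (e k) := by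
  choose n e t ht using hu
  obtain ⟨m, e', he'⟩ := exists_fin_range_supset e
  choose t' ht' using fun i => IsTermFun.subst_of_range_subset.{u, v} (σ := σ) (he' i) (t i)
  exact ⟨m, e', t', fun i M A => by rw [ht, ht']⟩

theorem IsFormulaFun.subst {σ : I → L.Sorts} {τ : J → L.Sorts}
    {F : ∀ M : MetricStructure.{u, v} L, (∀ i, M.carrier (σ i)) → ℝ} (hF : IsFormulaFun σ F)
    {u : ∀ i, ∀ M : MetricStructure.{u, v} L, (∀ j, M.carrier (τ j)) → M.carrier (σ i)}
    (hu : ∀ i, IsTermFun τ (σ i) (u i)) : IsFormulaFun τ fun M A => F M fun i => u i M A := by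
  obtain ⟨n, e, φ, hφ⟩ := hF
  obtain ⟨m, e', t, ht⟩ := IsTermFun.exists_common fun k => hu (e k)
  exact ⟨m, e', φ.subst t, fun M A => by
    rw [BasicFormula.eval_subst]; simp only [hφ, ht]⟩

theorem IsTermFun.app {σ : I → L.Sorts} (f : L.Funcs)
    {u : ∀ i, ∀ M : MetricStructure.{u, v} L, (∀ i, M.carrier (σ i)) → M.carrier (L.funcDom f i)}
    (hu : ∀ i, IsTermFun σ (L.funcDom f i) (u i)) :
    IsTermFun σ (L.funcCod f) fun M A => M.func f fun i => u i M A := by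
  obtain ⟨m, e', t, ht⟩ := IsTermFun.exists_common hu
  exact ⟨m, e', .app f t, fun M A => by simp only [Term.eval, ht]⟩

theorem IsFormulaFun.rel {σ : I → L.Sorts} (R : L.Rels)
    {u : ∀ i, ∀ M : MetricStructure.{u, v} L, (∀ i, M.carrier (σ i)) → M.carrier (L.relDom R i)}
    (hu : ∀ i, IsTermFun σ (L.relDom R i) (u i)) :
    IsFormulaFun σ fun M A => M.rel R fun i => u i M A := by
  obtain ⟨m, e', t, ht⟩ := IsTermFun.exists_common hu
  exact ⟨m, e', .rel R t, fun M A => by simp only [BasicFormula.eval, ht]⟩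

theorem IsFormulaFun.dist {σ : I → L.Sorts} {s : L.Sorts}
    {u w : ∀ M : MetricStructure.{u, v} L, (∀ i, M.carrier (σ i)) → M.carrier s}
    (hu : IsTermFun σ s u) (hw : IsTermFun σ s w) :
    IsFormulaFun σ fun M A => Dist.dist (u M A) (w M A) := by
  obtain ⟨m, e', t, ht⟩ := IsTermFun.exists_common (ι := Bool) (s := fun _ => s)
    (u := fun i => bif i then u else w) (by rintro (_ | _) <;> assumption)
  refine ⟨m, e', .dist (t true) (t false), fun M A => ?_⟩
  simp only [BasicFormula.eval, ← ht, cond_true, cond_false]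

theorem IsFormulaFun.conn {σ : I → L.Sorts} {k : ℕ} (f : C(Fin k → ℝ, ℝ))
    {F : Fin k → ∀ M : MetricStructure.{u, v} L, (∀ i, M.carrier (σ i)) → ℝ}
    (hF : ∀ i, IsFormulaFun σ (F i)) : IsFormulaFun σ fun M A => f fun i => F i M A := by
  choose n e φ hφ using hF
  obtain ⟨m, e', he'⟩ := exists_fin_range_supset e
  choose t ht using fun i => Term.exists_of_range_subset.{u, v} (σ := σ) (he' i)
  refine ⟨m, e', .conn f fun i => (φ i).subst (t i), fun M A => ?_⟩
  simp only [BasicFormula.eval, BasicFormula.eval_subst, ht, hφ]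

theorem IsFormulaFun.const (σ : I → L.Sorts) (r : ℝ) : IsFormulaFun.{u, v} σ fun _ _ => r :=
  .conn (k := 0) (F := fun i => i.elim0) ⟨fun _ => r, continuous_const⟩ fun i => i.elim0

theorem IsFormulaFun.comp {σ : I → L.Sorts}
    {F : ∀ M : MetricStructure.{u, v} L, (∀ i, M.carrier (σ i)) → ℝ} (hF : IsFormulaFun σ F)
    {f : ℝ → ℝ} (hf : Continuous f) : IsFormulaFun σ fun M A => f (F M A) :=
  .conn (k := 1) (F := fun _ => F) ⟨fun x => f (x 0), hf.comp (continuous_apply 0)⟩ fun _ => hF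

theorem IsFormulaFun.comp₂ {σ : I → L.Sorts}
    {F G : ∀ M : MetricStructure.{u, v} L, (∀ i, M.carrier (σ i)) → ℝ} (hF : IsFormulaFun σ F)
    (hG : IsFormulaFun σ G) {f : ℝ → ℝ → ℝ} (hf : Continuous fun x : ℝ × ℝ => f x.1 x.2) :
    IsFormulaFun σ fun M A => f (F M A) (G M A) :=
  .conn (k := 2) (F := ![F, G]) ⟨fun x => f (x 0) (x 1),
    hf.comp (f := fun x : Fin 2 → ℝ => (x 0, x 1)) (by fun_prop)⟩
    (by intro i; fin_cases i <;> assumption)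

/-- The maximum metric is the sup norm of the vector of coordinate distances, and this norm is a
continuous connective. -/
theorem IsFormulaFun.tupleDist {σ : I → L.Sorts} {n : ℕ} {c : Fin n → L.Sorts}
    {u w : ∀ i, ∀ M : MetricStructure.{u, v} L, (∀ i, M.carrier (σ i)) → M.carrier (c i)}
    (hu : ∀ i, IsTermFun σ (c i) (u i)) (hw : ∀ i, IsTermFun σ (c i) (w i)) :
    IsFormulaFun σ fun M A =>
      Dist.dist (fun i => u i M A : M.Tuple c) (fun i => w i M A : M.Tuple c) := by
  have := IsFormulaFun.conn ⟨fun x : Fin n → ℝ => ‖x‖, continuous_norm⟩ fun i =>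
    IsFormulaFun.dist (hu i) (hw i)
  convert this using 3 with M A
  change _ = ‖fun i => Dist.dist (u i M A) (w i M A)‖
  refine le_antisymm ((dist_pi_le_iff (norm_nonneg _)).2 fun i => ?_)
    ((pi_norm_le_iff_of_nonneg dist_nonneg).2 fun i => ?_)
  · exact (le_abs_self _).trans
      (norm_le_pi_norm (fun i => Dist.dist (u i M A) (w i M A)) i)
  · rw [Real.norm_of_nonneg dist_nonneg]
    exact dist_le_pi_dist (fun i => u i M A : M.Tuple c) (fun i => w i M A : M.Tuple c) i

theorem IsFormulaFun.exists_basic {n : ℕ} {c : Fin n → L.Sorts}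
    {F : ∀ M : MetricStructure.{u, v} L, M.Tuple c → ℝ} (hF : IsFormulaFun c F) :
    ∃ φ : BasicFormula L c, ∀ M a, φ.eval M a = F M a := by
  obtain ⟨m, e, φ, hφ⟩ := hF
  exact ⟨φ.subst fun k => .var (e k), fun M a => by rw [BasicFormula.eval_subst, hφ]; rfl⟩

theorem IsFormulaFun.continuous {σ : I → L.Sorts}
    {F : ∀ M : MetricStructure.{u, v} L, (∀ i, M.carrier (σ i)) → ℝ} (hF : IsFormulaFun σ F)
    (M : MetricStructure.{u, v} L) : Continuous (F M) := by
  obtain ⟨m, e, φ, hφ⟩ := hF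
  rw [show F M = fun A => φ.eval M fun k => A (e k) from funext fun A => hφ M A]
  exact (φ.continuous_eval M).comp (continuous_pi fun k => continuous_apply (e k))

/-- The infimum over a finite tuple of variables, in the form `G x < r ↔ ∃ y, F (x, y) < r`. -/
theorem IsFormulaFun.exists_inf {m : ℕ} : ∀ {n : ℕ} {c : Fin n → L.Sorts} {d : Fin m → L.Sorts}
    {F : ∀ M : MetricStructure.{u, v} L, M.Tuple c → M.Tuple d → ℝ}
    (_ : IsFormulaFun (Sum.elim c d) fun M A => F M (fun i => A (.inl i)) fun i => A (.inr i)),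
    ∃ φ : BasicFormula L c, ∀ M x r, φ.eval M x < r ↔ ∃ y, F M x y < r := by
  induction m with
  | zero =>
    intro n c d F hF
    have := hF.subst (τ := c) (u := fun i M A => Sum.casesOn
      (motive := fun i => M.carrier (Sum.elim c d i)) i A fun i => i.elim0) (by
        rintro (i | i)
        · exact .var c i
        · exact i.elim0)
    obtain ⟨φ, hφ⟩ := this.exists_basic
    refine ⟨φ, fun M x r => ?_⟩
    rw [hφ]
    exact ⟨fun h => ⟨_, h⟩, fun ⟨y, h⟩ => by
      rwa [Subsingleton.elim y fun i => i.elim0] at h⟩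
  | succ m ih =>
    intro n c d F hF
    -- The first bound variable is treated as an additional free one in front; the induction
    -- hypothesis removes the other m, and a single `inf` then removes this one.
    obtain ⟨φ, hφ⟩ := ih (c := (Fin.cons (d 0) c : Fin (n + 1) → L.Sorts))
      (d := fun i : Fin m => d i.succ)
      (F := fun M x y => F M (fun i => x i.succ)
        (Fin.cons (α := fun i => M.carrier (d i)) (x 0) y)) (by
        have := hF.subst (τ := Sum.elim (Fin.cons (d 0) c : Fin (n + 1) → L.Sorts)
            (fun i : Fin m => d i.succ))
          (u := fun i M A => Sum.casesOn (motive := fun i => M.carrier (Sum.elim c d i)) i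
            (fun i => A (.inl i.succ))
            fun i => Fin.cases (motive := fun i => M.carrier (d i)) (A (.inl 0))
              (fun i => A (.inr i)) i) (by
            rintro (i | i)
            · exact .var _ (Sum.inl i.succ)
            · induction i using Fin.cases with
              | zero => exact .var _ (Sum.inl 0)
              | succ i => exact .var _ (Sum.inr i))
        exact this)
    refine ⟨.inf (d 0) φ, fun M x r => ?_⟩
    rw [BasicFormula.eval_inf_lt]
    simp only [hφ]
    constructor
    · rintro ⟨b, y, h⟩
      exact ⟨_, h⟩
    · rintro ⟨y, h⟩
      refine ⟨y 0, fun i => y i.succ, ?_⟩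
      exact (congrArg (F M x) (Fin.cons_self_tail y)).trans_lt h

/-- Two families, joined into one. -/
def MetricStructure.sumFamily (M : MetricStructure.{u, v} L) {σ : I → L.Sorts} {τ : J → L.Sorts}
    (x : ∀ i, M.carrier (σ i)) (y : ∀ j, M.carrier (τ j)) (k : I ⊕ J) :
    M.carrier (Sum.elim σ τ k) :=
  Sum.casesOn (motive := fun k => M.carrier (Sum.elim σ τ k)) k x y

theorem MetricStructure.sumFamily_eta (M : MetricStructure.{u, v} L) {σ : I → L.Sorts}
    {τ : J → L.Sorts} (A : ∀ k, M.carrier (Sum.elim σ τ k)) :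
    M.sumFamily (fun i => A (.inl i)) (fun j => A (.inr j)) = A := by
  funext k
  cases k <;> rfl

theorem MetricStructure.exists_extension (M : MetricStructure.{u, v} L) {τ : J → L.Sorts} {m : ℕ}
    {f : Fin m → J} (hf : Function.Injective f) (y : ∀ k, M.carrier (τ (f k))) :
    ∃ A : ∀ j, M.carrier (τ j), ∀ k, A (f k) = y k := by
  classical
  refine ⟨fun i => if hi : ∃ k, f k = i then hi.choose_spec ▸ y hi.choose
    else (M.nonempty (τ i)).some, fun k => ?_⟩
  have hk : ∃ k', f k' = f k := ⟨k, rfl⟩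
  have : ∀ k' (h : f k' = f k), (h ▸ y k' : M.carrier (τ (f k))) = y k := by
    intro k' h
    obtain rfl := hf h
    rfl
  simp only [hk, dif_pos]
  exact this _ _

/-- The infimum over an arbitrary family of variables, of which only finitely many occur. -/
theorem IsFormulaFun.exists_inf_family {n : ℕ} {c : Fin n → L.Sorts} {τ : J → L.Sorts}
    {F : ∀ M : MetricStructure.{u, v} L, M.Tuple c → (∀ j, M.carrier (τ j)) → ℝ}
    (hF : IsFormulaFun (Sum.elim c τ) fun M A => F M (fun i => A (.inl i)) fun i => A (.inr i)) :
    ∃ φ : BasicFormula L c, ∀ M x r, φ.eval M x < r ↔ ∃ y, F M x y < r := by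
  obtain ⟨k, e, φ, hφ⟩ := hF
  -- An injective list of the bound variables that occur in φ. Injectivity allows values on this
  -- list to be extended to a whole family, as the sorts are non-empty.
  obtain ⟨m, f, hf, hfr⟩ := ((finite_range e).preimage Sum.inr_injective.injOn).fin_param
  have hu : ∀ j, ∃ u : ∀ M : MetricStructure.{u, v} L,
      (∀ i, M.carrier (Sum.elim c (fun k => τ (f k)) i)) → M.carrier (Sum.elim c τ (e j)),
      IsTermFun (Sum.elim c fun k => τ (f k)) _ u ∧ ∀ M x y,
        u M (M.sumFamily x fun k => y (f k)) = M.sumFamily x y (e j) := by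
    intro j
    rcases hj : e j with i | i
    · exact ⟨fun M A => A (.inl i), .var _ (Sum.inl i), fun _ _ _ => rfl⟩
    · obtain ⟨l, rfl⟩ : i ∈ range f := by
        rw [hfr]
        exact ⟨j, hj⟩
      exact ⟨fun M A => A (.inr l), .var _ (Sum.inr l), fun _ _ _ => rfl⟩
  choose u hu hu' using hu
  obtain ⟨ψ, hψ⟩ := IsFormulaFun.exists_inf (c := c) (d := fun k => τ (f k))
    (F := fun M x y => φ.eval M fun j => u j M (M.sumFamily x y)) (by
      have e : (fun (M : MetricStructure.{u, v} L) A => φ.eval M fun j =>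
          u j M (M.sumFamily (fun i => A (.inl i)) fun i => A (.inr i))) =
          fun M A => φ.eval M fun j => u j M A := by
        funext M A
        exact congrArg (fun B => φ.eval M fun j => u j M B) (M.sumFamily_eta A)
      exact e.symm ▸ φ.isFormulaFun.subst hu)
  have key : ∀ M x (y : ∀ j, MetricStructure.carrier M (τ j)), F M x y =
      φ.eval M fun j => u j M (M.sumFamily x fun k => y (f k)) := by
    intro M x y
    simp only [hu']
    exact hφ M (M.sumFamily x y)
  refine ⟨ψ, fun M x r => ?_⟩
  rw [hψ]
  constructor
  · rintro ⟨y, hy⟩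
    obtain ⟨A, hA⟩ := M.exists_extension hf y
    refine ⟨A, ?_⟩
    rw [key]
    simp only [hA]
    exact hy
  · rintro ⟨y, hy⟩
    rw [key] at hy
    exact ⟨_, hy⟩

end Definable

/-! ## Types and elementary equivalence in terms of basic formulas -/

theorem MetricStructure.tp_coe (M : MetricStructure.{u, v} L) {n : ℕ} {c : Fin n → L.Sorts}
    (a : M.Tuple c) (φ : BasicFormula L c) :
    M.tp a ((show BasicForm (univ : Set (MetricStructure.{u, v} L)) c from φ :
      BasicForm (univ : Set (MetricStructure.{u, v} L)) c) : LFormula.{u, v} L c) = φ.eval M a :=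
  Form.eval_coe (⟨M, mem_univ M⟩ : (univ : Set (MetricStructure.{u, v} L))) a φ

theorem MetricStructure.continuous_tp (M : MetricStructure.{u, v} L) {n : ℕ}
    {c : Fin n → L.Sorts} (a : M.Tuple c) : Continuous (M.tp a) :=
  Completion.continuous_extension

/-- Types are continuous on the completion, and the basic formulas are dense there. -/
theorem MetricStructure.tp_eq_iff {M N : MetricStructure.{u, v} L} {n : ℕ} {c : Fin n → L.Sorts}
    {a : M.Tuple c} {b : N.Tuple c} :
    M.tp a = N.tp b ↔ ∀ φ : BasicFormula L c, φ.eval M a = φ.eval N b := by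
  constructor
  · intro h φ
    rw [← M.tp_coe, ← N.tp_coe, h]
  · intro h
    refine Completion.denseRange_coe.equalizer (M.continuous_tp a) (N.continuous_tp b) ?_
    funext φ
    exact ((M.tp_coe a φ).trans (h φ)).trans (N.tp_coe b φ).symm

theorem MetricStructure.ElemEquiv.symm {M N : MetricStructure.{u, v} L} (h : M.ElemEquiv N) :
    N.ElemEquiv M :=
  Eq.symm h

/-- Elementary equivalence compares only the zero sets, but subtracting the constant φ^M from φ
gives a sentence that vanishes in M, so that all values agree. -/
theorem MetricStructure.elemEquiv_iff {M N : MetricStructure.{u, v} L} :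
    M.ElemEquiv N ↔ ∀ (φ : BasicFormula L (Fin.elim0 : Fin 0 → L.Sorts)) x y,
      φ.eval M x = φ.eval N y := by
  constructor
  · intro h φ x y
    obtain ⟨ψ, hψ⟩ := (φ.isFormulaFun.{u, v}.comp (f := fun r => r - φ.eval M x)
      (by fun_prop)).exists_basic
    have hx : (fun i : Fin 0 => i.elim0) = x := Subsingleton.elim _ _
    have hy : (fun i : Fin 0 => i.elim0) = y := Subsingleton.elim _ _
    have h0 := (Set.ext_iff.1 h ((show BasicForm (univ : Set (MetricStructure.{u, v} L)) _
      from ψ : BasicForm (univ : Set (MetricStructure.{u, v} L)) _) : Sentence.{u, v} L)).1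
    simp only [mem_ofPred_eq, MetricStructure.value, MetricStructure.tp_coe, hψ, hx, hy] at h0
    linarith [h0 (sub_self _)]
  · intro h
    have : M.tp (fun i : Fin 0 => i.elim0 : M.Tuple (Fin.elim0 : Fin 0 → L.Sorts)) =
        N.tp (fun i : Fin 0 => i.elim0) := MetricStructure.tp_eq_iff.2 fun φ => h φ _ _
    simp only [MetricStructure.ElemEquiv, MetricStructure.value, this]

/-- A satisfiable open condition is satisfiable in every elementarily equivalent structure. -/
theorem MetricStructure.ElemEquiv.exists_lt {M N : MetricStructure.{u, v} L} (h : M.ElemEquiv N)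
    {I : Type*} {σ : I → L.Sorts}
    {F : ∀ M : MetricStructure.{u, v} L, (∀ i, M.carrier (σ i)) → ℝ} (hF : IsFormulaFun σ F)
    {r : ℝ} (hM : ∃ A, F M A < r) : ∃ A, F N A < r := by
  obtain ⟨ψ, hψ⟩ := IsFormulaFun.exists_inf_family (c := (Fin.elim0 : Fin 0 → L.Sorts)) (τ := σ)
    (F := fun M _ A => F M A) (hF.subst (τ := Sum.elim (Fin.elim0 : Fin 0 → L.Sorts) σ)
      (u := fun i _ A => A (.inr i)) fun i => .var _ (Sum.inr i))
  rw [← hψ N fun i => i.elim0, ← MetricStructure.elemEquiv_iff.1 h ψ fun i => i.elim0, hψ]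
  exact hM

/-! ## Isomorphisms from dense families with the same type -/

/-- Pulling the metric of X back to J makes `a` uniformly inducing and `b` an isometry, so `b`
extends along `a`. The range of the extension is closed, X being complete, and contains the dense
range of `b`. -/
theorem exists_isometry_extend {X Y J : Type*} [MetricSpace X] [MetricSpace Y] [CompleteSpace X]
    [CompleteSpace Y] {a : J → X} {b : J → Y} (ha : DenseRange a) (hb : DenseRange b)
    (hab : ∀ i j, dist (a i) (a j) = dist (b i) (b j)) :
    ∃ f : X → Y, Isometry f ∧ Function.Surjective f ∧ ∀ j, f (a j) = b j := by
  let _ : PseudoMetricSpace J := PseudoMetricSpace.induced a inferInstance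
  have hu : IsUniformInducing a := ⟨rfl⟩
  have hbu : UniformContinuous b :=
    (Isometry.of_dist_eq (f := b) fun i j => (hab i j).symm).uniformContinuous
  have hd : IsDenseInducing a := hu.isDenseInducing ha
  have hf : Continuous (hd.extend b) :=
    (uniformContinuous_uniformly_extend hu ha hbu).continuous
  have hfa : ∀ j, hd.extend b (a j) = b j := hd.extend_eq hbu.continuous
  have hiso : Isometry (hd.extend b) := by
    refine Isometry.of_dist_eq fun x y => ?_
    refine ha.induction_on₂ (p := fun x y => dist (hd.extend b x) (hd.extend b y) = dist x y)
      (isClosed_eq (by fun_prop) (by fun_prop)) (fun i j => ?_) x y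
    rw [hfa, hfa, hab]
  refine ⟨_, hiso, ?_, hfa⟩
  rw [← range_eq_univ, ← hiso.isClosedEmbedding.isClosed_range.closure_eq]
  refine (hb.mono ?_).closure_eq
  rintro _ ⟨j, rfl⟩
  exact ⟨a j, hfa j⟩

section

variable {I : Type*} {σ : I → L.Sorts} {M N : MetricStructure.{u, v} L}
  {A : ∀ i, M.carrier (σ i)} {B : ∀ i, N.carrier (σ i)}

/-- The members of sort `s` of a family. -/
def MetricStructure.sortFamily (M : MetricStructure.{u, v} L) (A : ∀ i, M.carrier (σ i))
    (s : L.Sorts) (j : {i // σ i = s}) : M.carrier s :=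
  j.2 ▸ A j.1

theorem IsTermFun.sortFamily (σ : I → L.Sorts) {s : L.Sorts} (j : {i // σ i = s}) :
    IsTermFun.{u, v} σ s fun M A => M.sortFamily A s j :=
  .cast σ j.2

/-- The formulas d(x_i, x_j) give isometries sort by sort, the other atomic formulas make them
respect the symbols on dense sets of tuples, and continuity does the rest. -/
theorem MetricStructure.Iso.exists_of_dense
    (h : ∀ F : ∀ M : MetricStructure.{u, v} L, (∀ i, M.carrier (σ i)) → ℝ,
      IsFormulaFun σ F → F M A = F N B)
    (hA : ∀ s, DenseRange (M.sortFamily A s)) (hB : ∀ s, DenseRange (N.sortFamily B s)) :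
    Nonempty (M.Iso N) := by
  choose f hf hfs hfA using fun s => exists_isometry_extend (hA s) (hB s) fun i j =>
    h _ (.dist (.sortFamily σ i) (.sortFamily σ j))
  have hpi : ∀ {n : ℕ} (c : Fin n → L.Sorts),
      DenseRange fun (k : ∀ i, {j // σ j = c i}) i => M.sortFamily A (c i) (k i) := fun c =>
    DenseRange.piMap fun i => hA (c i)
  have hpc : ∀ {n : ℕ} (c : Fin n → L.Sorts),
      Continuous fun (x : M.Tuple c) (i : Fin n) => f (c i) (x i) := fun c =>
    continuous_pi fun i => (hf (c i)).continuous.comp (continuous_apply i)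
  have hfc : ∀ (P : MetricStructure.{u, v} L) (g : L.Funcs), Continuous (P.func g) := by
    intro P g
    rw [Metric.continuous_iff]
    intro b ε hε
    obtain ⟨δ, hδ, h⟩ := MetricStructure.func_uniform.{u, v} g (half_pos hε)
    exact ⟨δ, hδ, fun a hab => (h P a b ((dist_pi_lt_iff hδ).1 hab)).trans_lt (half_lt_self hε)⟩
  have hrc : ∀ (P : MetricStructure.{u, v} L) (R : L.Rels), Continuous (P.rel R) := by
    intro P g
    rw [Metric.continuous_iff]
    intro b ε hε
    obtain ⟨δ, hδ, h⟩ := MetricStructure.rel_uniform.{u, v} g (half_pos hε)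
    exact ⟨δ, hδ, fun a hab => (h P a b ((dist_pi_lt_iff hδ).1 hab)).trans_lt (half_lt_self hε)⟩
  refine ⟨⟨f, fun g a => ?_, fun R a => ?_, hf, hfs⟩⟩
  · refine (hpi (L.funcDom g)).induction_on
      (p := fun a => f _ (M.func g a) = N.func g fun i => f _ (a i)) a
      (isClosed_eq ((hf _).continuous.comp (hfc M g)) ((hfc N g).comp (hpc _))) fun k => ?_
    simp only [hfA]
    -- The value of a function symbol need not belong to the family; it is pinned down by its
    -- distance to a nearby member, which is a formula in the family.
    refine eq_of_dist_eq_zero (le_antisymm (le_of_forall_pos_le_add fun ε hε => ?_) dist_nonneg)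
    obtain ⟨j, hj⟩ := (hA _).exists_dist_lt
      (M.func g fun i => M.sortFamily A _ (k i)) (half_pos hε)
    have h1 : dist (M.func g fun i => M.sortFamily A _ (k i)) (M.sortFamily A _ j) =
        dist (N.func g fun i => N.sortFamily B _ (k i)) (N.sortFamily B _ j) :=
      h _ (.dist (.app g fun i => .sortFamily σ (k i)) (.sortFamily σ j))
    have h2 : dist (f _ (M.func g fun i => M.sortFamily A _ (k i))) (N.sortFamily B _ j) < ε / 2 := by
      rw [← hfA, (hf _).dist_eq]; exact hj
    linarith [dist_triangle_right (f _ (M.func g fun i => M.sortFamily A _ (k i)))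
      (N.func g fun i => N.sortFamily B _ (k i)) (N.sortFamily B _ j)]
  · refine (hpi (L.relDom R)).induction_on
      (p := fun a => M.rel R a = N.rel R fun i => f _ (a i)) a
      (isClosed_eq (hrc M R) ((hrc N R).comp (hpc _))) fun k => ?_
    simp only [hfA]
    exact h _ (.rel R fun i => .sortFamily σ (k i))

end

/-! ## Isomorphisms preserve formulas -/

theorem MetricStructure.Iso.eval_term {M N : MetricStructure.{u, v} L} (f : M.Iso N) {n : ℕ}
    {c : Fin n → L.Sorts} {s : L.Sorts} (t : Term L c s) (a : M.Tuple c) :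
    f.toFun s (t.eval M a) = t.eval N fun i => f.toFun _ (a i) := by
  induction t with
  | var i => rfl
  | app g ts ih => simp only [Term.eval, f.map_func, ih]

theorem MetricStructure.Iso.map_consTuple {M N : MetricStructure.{u, v} L} (f : M.Iso N) {n : ℕ}
    {c : Fin n → L.Sorts} {s : L.Sorts} (b : M.carrier s) (a : M.Tuple c) :
    (fun i => f.toFun _ (M.consTuple b a i)) =
      N.consTuple (f.toFun s b) fun i => f.toFun _ (a i) := by
  funext i
  induction i using Fin.cases with
  | zero => rfl
  | succ i => rfl

theorem MetricStructure.Iso.eval {M N : MetricStructure.{u, v} L} (f : M.Iso N) {n : ℕ}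
    {c : Fin n → L.Sorts} (φ : BasicFormula L c) (a : M.Tuple c) :
    φ.eval M a = φ.eval N fun i => f.toFun _ (a i) := by
  induction φ with
  | rel R ts => simp only [BasicFormula.eval, f.map_rel, f.eval_term]
  | dist t₁ t₂ => simp only [BasicFormula.eval, ← f.eval_term, (f.map_dist _).dist_eq]
  | conn g φ ih => simp only [BasicFormula.eval, ih]
  | sup s φ ih =>
    simp only [BasicFormula.eval, ih, f.map_consTuple]
    exact (f.surjective s).iSup_comp fun b => φ.eval N (N.consTuple b fun i => f.toFun _ (a i))
  | inf s φ ih =>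
    simp only [BasicFormula.eval, ih, f.map_consTuple]
    exact (f.surjective s).iInf_comp fun b => φ.eval N (N.consTuple b fun i => f.toFun _ (a i))

theorem MetricStructure.Iso.elemEquiv {M N : MetricStructure.{u, v} L} (f : M.Iso N) :
    M.ElemEquiv N :=
  MetricStructure.elemEquiv_iff.2 fun φ x y => by
    rw [f.eval, Subsingleton.elim (fun i => f.toFun _ (x i)) y]

/-! ## Compact structures -/

/-- If x has distance at least ε from the closed range, then the iterates of x are pairwise
ε-separated, so no subsequence of them converges. -/
theorem surjective_of_isometry_of_compactSpace {X : Type*} [MetricSpace X] [CompactSpace X]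
    {f : X → X} (hf : Isometry f) : Function.Surjective f := by
  by_contra hs
  rw [Function.Surjective] at hs
  push Not at hs
  obtain ⟨x, hx⟩ := hs
  have hcl : IsClosed (range f) := hf.isClosedEmbedding.isClosed_range
  obtain ⟨ε, hε, hball⟩ := Metric.isOpen_iff.1 hcl.isOpen_compl x
    (by rintro ⟨y, hy⟩; exact hx y hy)
  have hit : ∀ (m : ℕ) (y z : X), dist (f^[m] y) (f^[m] z) = dist y z := by
    intro m
    induction m with
    | zero => exact fun _ _ => rfl
    | succ m ih => intro y z; rw [Function.iterate_succ_apply, Function.iterate_succ_apply, ih, hf.dist_eq]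
  have hsep : ∀ m k : ℕ, ε ≤ dist (f^[m] x) (f^[m + (k + 1)] x) := by
    intro m k
    rw [Function.iterate_add_apply, hit, Function.iterate_succ_apply']
    by_contra! h
    exact hball (by rw [Metric.mem_ball']; exact h) ⟨_, rfl⟩
  obtain ⟨y, φ, hφ, hy⟩ := CompactSpace.tendsto_subseq fun m => f^[m] x
  obtain ⟨K, hK⟩ := Metric.cauchySeq_iff.1 hy.cauchySeq ε hε
  have h1 := hK K le_rfl (K + 1) K.le_succ
  have h2 := hφ K.lt_succ_self
  obtain ⟨k, hk⟩ := Nat.exists_eq_add_of_lt h2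
  have h3 := hsep (φ K) k
  simp only [Function.comp_apply, Nat.succ_eq_add_one] at h1 hk
  rw [hk, add_assoc] at h1
  linarith

/-- A family realizing the type of a given family exists in every compact elementarily equivalent
structure. -/
theorem MetricStructure.ElemEquiv.exists_family_of_isCompact {M N : MetricStructure.{u, v} L}
    (h : N.ElemEquiv M) (hM : M.IsCompact) {I : Type*} {σ : I → L.Sorts}
    (B : ∀ i, N.carrier (σ i)) : ∃ A : ∀ i, M.carrier (σ i),
      ∀ F : ∀ M : MetricStructure.{u, v} L, (∀ i, M.carrier (σ i)) → ℝ,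
        IsFormulaFun σ F → F N B = F M A := by
  have := fun i => hM (σ i)
  -- Each open condition true of B is relaxed to a closed one on the compact product of the sorts of
  -- M. These sets are non-empty by elementary equivalence and directed by means of `max`, so they
  -- have a common point.
  let K := {F : ∀ M : MetricStructure.{u, v} L, (∀ i, M.carrier (σ i)) → ℝ //
    IsFormulaFun σ F ∧ F N B < 0}
  let t : K → Set (∀ i, M.carrier (σ i)) := fun F => {A | F.1 M A ≤ 0}
  have hne : Nonempty K := ⟨⟨_, .const σ (-1), by norm_num⟩⟩
  have htc : ∀ F, IsClosed (t F) := fun F => isClosed_le (F.2.1.continuous M) continuous_const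
  obtain ⟨A, hA⟩ := IsCompact.nonempty_iInter_of_directed_nonempty_isCompact_isClosed t
    (fun F G => ⟨⟨_, F.2.1.comp₂ G.2.1 continuous_max, max_lt F.2.2 G.2.2⟩,
      fun A hA => (le_max_left (F.1 M A) (G.1 M A)).trans hA,
      fun A hA => (le_max_right (F.1 M A) (G.1 M A)).trans hA⟩)
    (fun F => (h.exists_lt F.2.1 ⟨B, F.2.2⟩).imp fun A hA => hA.le)
    (fun F => (htc F).isCompact) htc
  rw [mem_iInter] at hA
  refine ⟨A, fun F hF => le_antisymm ?_ ?_⟩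
  · refine le_of_forall_pos_le_add fun ε hε => ?_
    -- This function has the value -ε at B, so it belongs to `K`; at A it bounds the difference of
    -- the two values by ε.
    have := hA ⟨_, hF.comp (f := fun r => F N B - r - ε) (by fun_prop), by simpa using hε⟩
    simp only [t, mem_ofPred_eq] at this
    linarith
  · refine le_of_forall_pos_le_add fun ε hε => ?_
    have := hA ⟨_, hF.comp (f := fun r => r - F N B - ε) (by fun_prop), by simpa using hε⟩
    simp only [t, mem_ofPred_eq] at this
    linarith

theorem MetricStructure.ElemEquiv.exists_map_of_isCompact {M N : MetricStructure.{u, v} L}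
    (h : N.ElemEquiv M) (hM : M.IsCompact) : ∃ A : ∀ i : Σ s, N.carrier s, M.carrier i.1,
      (∀ s, Isometry fun x => A ⟨s, x⟩) ∧
      ∀ F : ∀ M : MetricStructure.{u, v} L, (∀ i : Σ s, N.carrier s, M.carrier i.1) → ℝ,
        IsFormulaFun Sigma.fst F → F N Sigma.snd = F M A := by
  obtain ⟨A, hA⟩ := h.exists_family_of_isCompact hM (σ := Sigma.fst) (Sigma.snd (β := N.carrier))
  refine ⟨A, fun s => Isometry.of_dist_eq fun x y => ?_, hA⟩
  exact (hA _ (.dist (s := s) (.var Sigma.fst (⟨s, x⟩ : Σ s, N.carrier s))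
    (.var Sigma.fst (⟨s, y⟩ : Σ s, N.carrier s)))).symm

/-- Type-preserving isometric maps exist in both directions. Their composite from M to itself is an
isometry of compact spaces, hence onto, and so the map from N to M is onto. -/
theorem MetricStructure.ElemEquiv.nonempty_iso_of_isCompact {M N : MetricStructure.{u, v} L}
    (h : N.ElemEquiv M) (hM : M.IsCompact) : Nonempty (N.Iso M) := by
  obtain ⟨A, hA, hAF⟩ := h.exists_map_of_isCompact hM
  have hN : N.IsCompact := fun s => by
    have := hM s
    exact (hA s).isClosedEmbedding.compactSpace
  obtain ⟨B, hB, -⟩ := h.symm.exists_map_of_isCompact hN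
  refine MetricStructure.Iso.exists_of_dense hAF (fun s => ?_) fun s => ?_
  · exact Function.Surjective.denseRange fun x => ⟨⟨⟨s, x⟩, rfl⟩, rfl⟩
  · refine Function.Surjective.denseRange fun y => ?_
    have := hM s
    obtain ⟨x, hx⟩ := surjective_of_isometry_of_compactSpace ((hA s).comp (hB s)) y
    exact ⟨⟨⟨s, _⟩, rfl⟩, hx⟩

/-! ## Density characters -/

theorem densityCharacter_le_aleph0_iff {X : Type w} [TopologicalSpace X] :
    densityCharacter X ≤ Cardinal.aleph0 ↔ TopologicalSpace.SeparableSpace X := by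
  constructor
  · intro h
    obtain ⟨s, hs, hc⟩ : densityCharacter X ∈
        {κ : Cardinal.{w} | ∃ s : Set X, Dense s ∧ Cardinal.mk s = κ} :=
      csInf_mem ⟨_, univ, dense_univ, rfl⟩
    exact ⟨s, Cardinal.le_aleph0_iff_set_countable.1 (hc.trans_le h), hs⟩
  · rintro ⟨s, hs, hd⟩
    have hm : Cardinal.mk s ∈ {κ : Cardinal.{w} | ∃ s : Set X, Dense s ∧ Cardinal.mk s = κ} :=
      ⟨s, hd, rfl⟩
    exact (csInf_le' hm).trans (Cardinal.le_aleph0_iff_set_countable.2 hs)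

theorem finite_of_densityCharacter_lt {X : Type w} [TopologicalSpace X] [T1Space X]
    (h : densityCharacter X < Cardinal.aleph0) : Finite X := by
  obtain ⟨s, hs, hc⟩ : densityCharacter X ∈
      {κ : Cardinal.{w} | ∃ s : Set X, Dense s ∧ Cardinal.mk s = κ} :=
    csInf_mem ⟨_, univ, dense_univ, rfl⟩
  have hf : s.Finite := Cardinal.lt_aleph0_iff_set_finite.1 (hc.trans_lt h)
  rw [← finite_univ_iff, ← hs.closure_eq, hf.isClosed.closure_eq]
  exact hf

theorem MetricStructure.le_density (M : MetricStructure.{u, v} L) (s : L.Sorts) :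
    Cardinal.lift.{u} (densityCharacter (M.carrier s)) ≤ M.density :=
  le_ciSup Cardinal.bddAbove_of_small s

theorem MetricStructure.isSeparable_iff (M : MetricStructure.{u, v} L) :
    M.IsSeparable ↔ ∀ s, TopologicalSpace.SeparableSpace (M.carrier s) := by
  simp only [← densityCharacter_le_aleph0_iff]
  constructor
  · intro h s
    have := (M.le_density s).trans h
    rwa [Cardinal.lift_le_aleph0] at this
  · intro h
    exact ciSup_le' fun s => Cardinal.lift_le_aleph0.2 (h s)

/-- A density below ℵ₀ means that every sort has a finite dense subset, which is closed; then every
sort is finite and hence compact. -/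
theorem MetricStructure.density_eq_of_not_isCompact {M : MetricStructure.{u, v} L}
    (h : M.IsSeparable) (hc : ¬ M.IsCompact) : M.density = Cardinal.aleph0 := by
  refine le_antisymm h ?_
  by_contra! hlt
  refine hc fun s => ?_
  have := (M.le_density s).trans_lt hlt
  rw [Cardinal.lift_lt_aleph0] at this
  have := finite_of_densityCharacter_lt this
  infer_instance

/-! ## Approximation of general formulas by basic formulas -/

/-- Evaluation at a tuple of a structure in K is 1-Lipschitz for the norm that defines the
completion, so one approximant serves all of K. -/
theorem Form.exists_basic_approx {K : Set (MetricStructure.{u, v} L)} {n : ℕ}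
    {c : Fin n → L.Sorts} (D : Form K c) {η : ℝ} (hη : 0 < η) :
    ∃ θ : BasicFormula L c, ∀ (M : K) (a : M.1.Tuple c), |Form.eval M a D - θ.eval M.1 a| < η := by
  obtain ⟨θ, hθ⟩ := (Completion.denseRange_coe (α := BasicForm K c)).exists_dist_lt D hη
  refine ⟨θ, fun M a => ?_⟩
  have hl : LipschitzWith 1 fun φ : BasicForm K c => BasicFormula.eval M.1 φ a :=
    LipschitzWith.of_dist_le_mul fun φ ψ => by
      rw [NNReal.coe_one, one_mul, Real.dist_eq]
      exact le_sSup_gapSet φ ψ M.2 a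
  have := hl.completion_extension.dist_le_mul D (θ : Form K c)
  rw [NNReal.coe_one, one_mul] at this
  refine lt_of_le_of_lt ?_ hθ
  rw [← Real.dist_eq, ← Form.eval_coe M a θ]
  exact this

theorem MetricStructure.distTo_eq_zero {M : MetricStructure.{u, v} L} {n : ℕ}
    {c : Fin n → L.Sorts} {a : M.Tuple c} {X : Set (M.Tuple c)} (h : a ∈ X) :
    M.distTo a X = 0 := by
  rw [MetricStructure.distTo, if_pos ⟨a, h⟩, Metric.infDist_zero_of_mem h]

/-- The convention for the empty set is used here: a value below one of the sort bounds forces X to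
be non-empty. This is how a distance formula produces realizations in a model not known to have any.
-/
theorem MetricStructure.exists_dist_lt_of_distTo_lt {M : MetricStructure.{u, v} L} {n : ℕ}
    {c : Fin n → L.Sorts} {a : M.Tuple c} {X : Set (M.Tuple c)} {r : ℝ} (h : M.distTo a X < r)
    {i : Fin n} (hi : r ≤ L.sortBound (c i)) : ∃ b ∈ X, dist a b < r := by
  rw [MetricStructure.distTo] at h
  split_ifs at h with hX
  · exact (Metric.infDist_lt_iff hX).1 h
  · have := le_ciSup (f := fun i => L.sortBound (c i)) (finite_range _).bddAbove i
    linarith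

/-! ## Back and forth -/

section BackAndForth

variable {M N : MetricStructure.{u, v} L} {c : ℕ → L.Sorts}

/-- The first `k` entries of two sequences have the same type. -/
def MetricStructure.InitialTypeEq (k : ℕ) (a : ∀ i, M.carrier (c i)) (b : ∀ i, N.carrier (c i)) :
    Prop :=
  ∀ φ : BasicFormula L fun i : Fin k => c i, φ.eval M (fun i => a i) = φ.eval N fun i => b i

theorem MetricStructure.InitialTypeEq.symm {k : ℕ} {a : ∀ i, M.carrier (c i)}
    {b : ∀ i, N.carrier (c i)} (h : MetricStructure.InitialTypeEq k a b) :
    MetricStructure.InitialTypeEq k b a :=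
  fun φ => (h φ).symm

/-- A tuple with a new last entry. -/
def MetricStructure.snocTuple (M : MetricStructure.{u, v} L) {k : ℕ}
    (x : M.Tuple fun i : Fin k => c i) (y : M.carrier (c k)) :
    M.Tuple fun i : Fin (k + 1) => c i :=
  fun i => Fin.lastCases (motive := fun i : Fin (k + 1) => M.carrier (c i)) y x i

theorem MetricStructure.snocTuple_eq (x : ∀ i, M.carrier (c i)) {k : ℕ} :
    M.snocTuple (fun i : Fin k => x i) (x k) = fun i : Fin (k + 1) => x i := by
  funext i
  induction i using Fin.lastCases with
  | last => exact Fin.lastCases_last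
  | cast i => exact Fin.lastCases_castSucc (motive := fun i : Fin (k + 1) => M.carrier (c i)) i

theorem IsTermFun.snocTuple (c : ℕ → L.Sorts) (k : ℕ) (i : Fin (k + 1)) :
    IsTermFun.{u, v} (Sum.elim (fun i : Fin k => c i) fun _ : Fin 1 => c k) (c i) fun P A =>
      P.snocTuple (fun i => A (.inl i)) (A (.inr 0)) i := by
  induction i using Fin.lastCases with
  | last =>
    have : (fun (P : MetricStructure.{u, v} L) A => P.snocTuple (c := c)
        (fun i : Fin k => A (.inl i)) (A (.inr 0)) (Fin.last k)) =
        fun (P : MetricStructure.{u, v} L) (A : ∀ i, P.carrier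
          (Sum.elim (fun i : Fin k => c i) (fun _ : Fin 1 => c k) i)) => A (.inr 0) := by
      funext P A
      exact Fin.lastCases_last
    exact this ▸ .var _ (Sum.inr 0)
  | cast j =>
    have : (fun (P : MetricStructure.{u, v} L) A => P.snocTuple (c := c)
        (fun i : Fin k => A (.inl i)) (A (.inr 0)) j.castSucc) =
        fun (P : MetricStructure.{u, v} L) (A : ∀ i, P.carrier
          (Sum.elim (fun i : Fin k => c i) (fun _ : Fin 1 => c k) i)) => A (.inl j) := by
      funext P A
      exact Fin.lastCases_castSucc (motive := fun i : Fin (k + 1) => P.carrier (c i)) j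
    exact this ▸ .var _ (Sum.inl j)

/-- The distance to the type of the extended tuple is a formula, and its infimum over the last
coordinate is 0 at `a`. Equality of types makes it small at `b`, and near a tuple where the distance
is small there is a realization. -/
theorem MetricStructure.InitialTypeEq.exists_extension {T : Set (Sentence.{u, v} L)} {k : ℕ}
    {a : ∀ i, M.carrier (c i)} {b : ∀ i, N.carrier (c i)} (hM : IsAtomicModel T M)
    (hN : N ∈ Mod T) (h : MetricStructure.InitialTypeEq k a b) (y : M.carrier (c k)) {ε : ℝ}
    (hε : 0 < ε) :
    ∃ b' : ∀ i, N.carrier (c i),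
      MetricStructure.InitialTypeEq (k + 1) (Function.update a k y) b' ∧
        ∀ i < k, dist (b i) (b' i) ≤ ε := by
  set a' := Function.update a k y with ha'
  have haa : (fun i : Fin k => a i) = fun i : Fin k => a' i := by
    funext i
    rw [ha', Function.update_of_ne i.2.ne]
  obtain ⟨D, hD⟩ := hM.2 (fun i : Fin (k + 1) => c i) fun i => a' i
  -- The value of θ found below is under η and approximates D up to η, so D < 2η. The third ensures
  -- 2η ≤ ε, and 2η ≤ the bound of the last sort, so that a realization exists.
  set η := min ε (L.sortBound (c k)) / 3 with hη
  have hη0 : 0 < η := div_pos (lt_min hε (L.sortBound_pos _)) (by norm_num)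
  obtain ⟨θ, hθ⟩ := D.exists_basic_approx hη0
  obtain ⟨ψ, hψ⟩ := IsFormulaFun.exists_inf (c := fun i : Fin k => c i)
    (d := fun _ : Fin 1 => c k) (F := fun P x z => θ.eval P (P.snocTuple x (z 0)))
    (θ.isFormulaFun.subst (IsTermFun.snocTuple c k))
  have h1 : ψ.eval M (fun i => a i) < η := by
    refine (hψ _ _ _).2 ⟨fun _ => a' k, ?_⟩
    rw [haa, MetricStructure.snocTuple_eq]
    have h2 := hθ ⟨M, hM.1⟩ fun i => a' i
    rw [hD, MetricStructure.distTo_eq_zero (by rfl), zero_sub, abs_neg] at h2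
    exact (le_abs_self _).trans_lt h2
  rw [h ψ, hψ] at h1
  obtain ⟨z, hz⟩ := h1
  have h2 := hθ ⟨N, hN⟩ (N.snocTuple (fun i => b i) (z 0))
  rw [hD, abs_lt] at h2
  obtain ⟨w, hw, hwd⟩ := MetricStructure.exists_dist_lt_of_distTo_lt (r := 2 * η)
    (i := Fin.last k) (by linarith [h2.2]) (by
      have := min_le_right ε (L.sortBound (c k))
      have : 2 * η ≤ L.sortBound (c k) := by linarith
      exact this)
  refine ⟨fun i => if hi : i < k + 1 then w ⟨i, hi⟩ else b i, fun φ => ?_, fun i hi => ?_⟩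
  · have hw' : (fun i : Fin (k + 1) => (if hi : (i : ℕ) < k + 1 then w ⟨i, hi⟩ else b i :
        N.carrier (c i))) = w := by
      funext i
      simp only [i.2, dif_pos]
    rw [hw']
    exact (MetricStructure.tp_eq_iff.1 hw φ).symm
  · simp only [Nat.lt_succ_of_lt hi, dif_pos]
    have h3 := dist_le_pi_dist (N.snocTuple (fun i => b i) (z 0)) w (Fin.castSucc ⟨i, hi⟩)
    have h4 : N.snocTuple (fun i => b i) (z 0) (Fin.castSucc ⟨i, hi⟩) = b i :=
      Fin.lastCases_castSucc (motive := fun i : Fin (k + 1) => N.carrier (c i)) ⟨i, hi⟩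
    rw [h4] at h3
    have := min_le_left ε (L.sortBound (c k))
    have h5 : dist (b i) (w ⟨i, Nat.lt_succ_of_lt hi⟩) ≤ 2 * η := h3.trans hwd.le
    linarith

theorem MetricStructure.InitialTypeEq.eval_eq {k : ℕ} {a : ∀ i, M.carrier (c i)}
    {b : ∀ i, N.carrier (c i)} (h : MetricStructure.InitialTypeEq k a b) {n : ℕ} {e : Fin n → ℕ}
    (he : ∀ j, e j < k) (φ : BasicFormula L fun j => c (e j)) :
    φ.eval M (fun j => a (e j)) = φ.eval N fun j => b (e j) := by
  have := h (φ.subst fun j => .var (c := fun i : Fin k => c i) ⟨e j, he j⟩)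
  simp only [BasicFormula.eval_subst] at this
  exact this

/-- Each member of the dense sequences is the target at arbitrarily late stages k, where the error
is at most 2^(-k). -/
theorem MetricStructure.denseRange_sortFamily {A : ∀ i, M.carrier (c i)} {x : ∀ s, ℕ → M.carrier s}
    (hx : ∀ s, DenseRange (x s)) {p : ℕ → Prop} {j : ℕ → ℕ}
    (hp : ∀ s l K, ∃ k ≥ K, c k = s ∧ j k = l ∧ p k)
    (hA : ∀ k, p k → dist (x (c k) (j k)) (A k) ≤ (1 / 2) ^ k) (s : L.Sorts) :
    DenseRange (M.sortFamily A s) := by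
  refine Metric.dense_iff.2 fun y ε hε => ?_
  obtain ⟨l, hl⟩ := (hx s).exists_dist_lt y (half_pos hε)
  obtain ⟨K, hK⟩ := exists_pow_lt_of_lt_one (half_pos hε) (by norm_num : (1 / 2 : ℝ) < 1)
  obtain ⟨k, hk, rfl, rfl, hpk⟩ := hp s l K
  refine ⟨A k, ?_, ⟨⟨k, rfl⟩, rfl⟩⟩
  rw [Metric.mem_ball']
  have h1 := hA k hpk
  have h2 : (1 / 2 : ℝ) ^ k ≤ (1 / 2) ^ K :=
    pow_le_pow_of_le_one (by norm_num) (by norm_num) hk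
  linarith [dist_triangle y (x (c k) (j k)) (A k)]

/-- In the back-and-forth, coordinate i is set at stage i and controlled only from stage i + 1 on;
the remaining moves sum to 2^(-(i+1)) + 2^(-(i+2)) + … = 2^(-i). -/
theorem exists_limit_of_dist_le {X : Type*} [MetricSpace X] [CompleteSpace X] {f : ℕ → X} {i : ℕ}
    (h : ∀ k, i < k → dist (f k) (f (k + 1)) ≤ (1 / 2) ^ k) :
    ∃ x, Filter.Tendsto f Filter.atTop (nhds x) ∧ dist (f (i + 1)) x ≤ (1 / 2) ^ i := by
  have hg : ∀ n, dist (f (n + (i + 1))) (f (n + 1 + (i + 1))) ≤ (1 / 2 : ℝ) ^ i / 2 / 2 ^ n := by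
    intro n
    have := h (n + (i + 1)) (by omega)
    rw [show n + 1 + (i + 1) = n + (i + 1) + 1 by ring]
    refine this.trans_eq ?_
    rw [pow_add, pow_add, one_div_pow, one_div_pow]
    field_simp
  obtain ⟨x, hx⟩ := cauchySeq_tendsto_of_complete (cauchySeq_of_le_geometric_two hg)
  refine ⟨x, (Filter.tendsto_add_atTop_iff_nat (i + 1)).1 hx, ?_⟩
  have := dist_le_of_le_geometric_two_of_tendsto₀ hg hx
  rwa [zero_add] at this

/-- Enumerating α × ℕ and forgetting the second entry makes every element recur infinitely often. -/
theorem exists_enumeration (α : Type*) [Countable α] [Nonempty α] :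
    ∃ g : ℕ → α, ∀ x K, ∃ k ≥ K, g k = x := by
  obtain ⟨g, hg⟩ := exists_surjective_nat (α × ℕ)
  refine ⟨fun k => (g k).1, fun x K => ?_⟩
  choose k hk using fun m => hg (x, m)
  have hinj : Function.Injective k := fun m m' h => by
    have := (hk m).symm.trans ((congrArg g h).trans (hk m'))
    exact (Prod.mk.inj this).2
  obtain ⟨m, hm⟩ := Set.infinite_of_injective_forall_mem (s := range k) hinj
    (fun m => ⟨m, rfl⟩) |>.exists_gt K
  obtain ⟨⟨m', rfl⟩, hlt⟩ := hm
  exact ⟨_, hlt.le, by simp [hk]⟩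

/-- Stage k puts a prescribed point of one of the models at coordinate k, matches it in the other
model, and moves earlier coordinates by at most 2^(-k). The coordinatewise limits have the same
type, because every formula uses finitely many coordinates, and they are dense. -/
theorem MetricStructure.nonempty_iso_of_isAtomicModel {T : Set (Sentence.{u, v} L)}
    [Countable L.Sorts] (hM : IsAtomicModel T M) (hN : IsAtomicModel T N) (hMs : M.IsSeparable)
    (hNs : N.IsSeparable) (h : M.ElemEquiv N) : Nonempty (M.Iso N) := by
  -- Without sorts there is nothing to enumerate, and formulas have no variables, so elementary
  -- equivalence suffices.
  rcases isEmpty_or_nonempty L.Sorts with hS | hS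
  · have h0 : ∀ (F : ∀ M : MetricStructure.{u, v} L, (∀ i : L.Sorts, M.carrier i) → ℝ),
        IsFormulaFun id F → F M (fun i => hS.elim i) = F N fun i => hS.elim i := by
      rintro F ⟨n, e, φ, hφ⟩
      have hn : n = 0 := by
        rcases n with - | n
        · rfl
        · exact hS.elim (e 0)
      subst hn
      rw [hφ, hφ]
      have := MetricStructure.elemEquiv_iff.1 h (φ.subst fun i => i.elim0) (fun i => i.elim0)
        fun i => i.elim0
      simp only [BasicFormula.eval_subst] at this
      convert this using 2
    exact MetricStructure.Iso.exists_of_dense h0 (fun s => hS.elim s) fun s => hS.elim s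
  -- Stage k reads off the sort of coordinate k, the side on which it is prescribed (`true` for M),
  -- and the index in the dense sequence of that side.
  obtain ⟨g, hg⟩ := exists_enumeration (L.Sorts × Bool × ℕ)
  let c : ℕ → L.Sorts := fun k => (g k).1
  have hsM := M.isSeparable_iff.1 hMs
  have hsN := N.isSeparable_iff.1 hNs
  let x : ∀ s, ℕ → M.carrier s := fun s => TopologicalSpace.denseSeq _
  let y : ∀ s, ℕ → N.carrier s := fun s => TopologicalSpace.denseSeq _
  let St : ℕ → Type v := fun k => {p : (∀ i, M.carrier (c i)) × (∀ i, N.carrier (c i)) //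
    MetricStructure.InitialTypeEq k p.1 p.2}
  have hstep : ∀ k (p : St k), ∃ q : St (k + 1),
      (∀ i < k, dist (p.1.1 i) (q.1.1 i) ≤ (1 / 2) ^ k ∧ dist (p.1.2 i) (q.1.2 i) ≤ (1 / 2) ^ k) ∧
      ((g k).2.1 = true → q.1.1 k = x (c k) (g k).2.2) ∧
      ((g k).2.1 = false → q.1.2 k = y (c k) (g k).2.2) := by
    rintro k ⟨⟨a, b⟩, hab⟩
    have hpos : (0 : ℝ) < (1 / 2) ^ k := by positivity
    rcases hb : (g k).2.1
    · obtain ⟨a', ha', hd⟩ := hab.symm.exists_extension hN hM.1 (y (c k) (g k).2.2) hpos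
      refine ⟨⟨(a', _), ha'.symm⟩, fun i hi => ⟨hd i hi, ?_⟩, by simp, fun _ =>
        Function.update_self ..⟩
      exact (dist_le_zero.2 (Function.update_of_ne hi.ne _ _).symm).trans hpos.le
    · obtain ⟨b', hb', hd⟩ := hab.exists_extension hM hN.1 (x (c k) (g k).2.2) hpos
      refine ⟨⟨(_, b'), hb'⟩, fun i hi => ⟨?_, hd i hi⟩, fun _ =>
        Function.update_self .., by simp⟩
      exact (dist_le_zero.2 (Function.update_of_ne hi.ne _ _).symm).trans hpos.le
  choose next hnext hnx hny using hstep
  let s0 : St 0 := ⟨(fun i => x (c i) 0, fun i => y (c i) 0), fun φ => by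
    have := MetricStructure.elemEquiv_iff.1 h (φ.subst fun i => i.elim0) (fun i => i.elim0)
      fun i => i.elim0
    simp only [BasicFormula.eval_subst] at this
    convert this using 2⟩
  let st : ∀ k, St k := fun k => Nat.rec s0 next k
  have hA : ∀ i, ∃ z, Filter.Tendsto (fun k => (st k).1.1 i) Filter.atTop (nhds z) ∧
      dist ((st (i + 1)).1.1 i) z ≤ (1 / 2) ^ i :=
    fun i => exists_limit_of_dist_le fun k hk => (hnext k (st k) i hk).1
  have hB : ∀ i, ∃ z, Filter.Tendsto (fun k => (st k).1.2 i) Filter.atTop (nhds z) ∧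
      dist ((st (i + 1)).1.2 i) z ≤ (1 / 2) ^ i :=
    fun i => exists_limit_of_dist_le fun k hk => (hnext k (st k) i hk).2
  choose A hA hA' using hA
  choose B hB hB' using hB
  refine MetricStructure.Iso.exists_of_dense (σ := c) (A := A) (B := B) (fun F hF => ?_) ?_ ?_
  · have h1 : Filter.Tendsto (fun k => F M (st k).1.1) Filter.atTop (nhds (F M A)) :=
      (hF.continuous M).continuousAt.tendsto.comp (tendsto_pi_nhds.2 hA)
    have h2 : Filter.Tendsto (fun k => F N (st k).1.2) Filter.atTop (nhds (F N B)) :=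
      (hF.continuous N).continuousAt.tendsto.comp (tendsto_pi_nhds.2 hB)
    refine tendsto_nhds_unique_of_eventuallyEq h1 h2 ?_
    obtain ⟨n, e, φ, hφ⟩ := hF
    obtain ⟨K, hK⟩ := (finite_range e).bddAbove
    filter_upwards [Filter.eventually_gt_atTop K] with k hk
    rw [hφ, hφ]
    exact (st k).2.eval_eq (fun j => (hK ⟨j, rfl⟩).trans_lt hk) φ
  · refine MetricStructure.denseRange_sortFamily (x := x) (p := fun k => (g k).2.1 = true)
      (j := fun k => (g k).2.2) (fun s => TopologicalSpace.denseRange_denseSeq _)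
      (fun s l K => ?_) fun k hk => ?_
    · obtain ⟨k, hk, hgk⟩ := hg (s, true, l) K
      exact ⟨k, hk, by simp [c, hgk], by simp [hgk], by simp [hgk]⟩
    · rw [← hnx k (st k) hk]
      exact hA' k
  · refine MetricStructure.denseRange_sortFamily (x := y) (p := fun k => (g k).2.1 = false)
      (j := fun k => (g k).2.2) (fun s => TopologicalSpace.denseRange_denseSeq _)
      (fun s l K => ?_) fun k hk => ?_
    · obtain ⟨k, hk, hgk⟩ := hg (s, false, l) K
      exact ⟨k, hk, by simp [c, hgk], by simp [hgk], by simp [hgk]⟩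
    · rw [← hny k (st k) hk]
      exact hB' k

end BackAndForth

/-! ## Elementary substructures -/

/-- The Tarski–Vaught condition for a family of subsets of the sorts of a structure. -/
def MetricStructure.TarskiVaught (M : MetricStructure.{u, v} L) (D : ∀ s, Set (M.carrier s)) :
    Prop :=
  ∀ (n : ℕ) (c : Fin n → L.Sorts) (s : L.Sorts)
    (φ : BasicFormula L (Fin.cons s c : Fin (n + 1) → L.Sorts)) (x : M.Tuple c),
    (∀ i, x i ∈ D (c i)) → ∀ r : ℝ, (∃ y, φ.eval M (M.consTuple y x) < r) →
      ∃ y ∈ D s, φ.eval M (M.consTuple y x) < r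

theorem MetricStructure.TarskiVaught.closure {M : MetricStructure.{u, v} L}
    {D : ∀ s, Set (M.carrier s)} (hD : M.TarskiVaught D) :
    M.TarskiVaught fun s => closure (D s) := by
  rintro n c s φ x hx r ⟨b, hb⟩
  -- One ε is lost in replacing x by x', one makes the strict bound for the witness, and one is lost
  -- in returning to x.
  set ε := (r - φ.eval M (M.consTuple b x)) / 3 with hε
  have hε0 : 0 < ε := div_pos (sub_pos.2 hb) (by norm_num)
  obtain ⟨δ, hδ, h⟩ := BasicFormula.eval_uniform.{u, v} φ ε hε0
  choose x' hx' hxx' using fun i => Metric.mem_closure_iff.1 (hx i) δ hδ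
  have hδ' : ∀ z : M.carrier s, dist z z < δ := fun z => by rwa [dist_self]
  have h1 := h M _ _ (M.dist_consTuple_lt (hδ' b) hxx')
  rw [abs_le] at h1
  obtain ⟨y, hy, hyr⟩ := hD n c s φ x' hx' (φ.eval M (M.consTuple b x) + 2 * ε)
    ⟨b, by linarith [h1.1]⟩
  have h2 := h M _ _ (M.dist_consTuple_lt (hδ' y) hxx')
  rw [abs_le] at h2
  exact ⟨y, subset_closure hy, by linarith [h2.2]⟩

theorem MetricStructure.TarskiVaught.nonempty {M : MetricStructure.{u, v} L}
    {D : ∀ s, Set (M.carrier s)} (hD : M.TarskiVaught D) (s : L.Sorts) : (D s).Nonempty := by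
  obtain ⟨φ, hφ⟩ := (IsFormulaFun.const.{u, v}
    (Fin.cons s Fin.elim0 : Fin (0 + 1) → L.Sorts) 0).exists_basic
  obtain ⟨y₀⟩ := M.nonempty s
  obtain ⟨y, hy, -⟩ := hD 0 Fin.elim0 s φ (fun i => i.elim0) (fun i => i.elim0) 1 ⟨y₀, by rw [hφ]; exact one_pos⟩
  exact ⟨y, hy⟩

/-- The condition, applied to the formula d(f(x), y), gives members of D as close to f(x) as
desired. -/
theorem MetricStructure.TarskiVaught.func_mem {M : MetricStructure.{u, v} L}
    {D : ∀ s, Set (M.carrier s)} (hD : M.TarskiVaught D) (f : L.Funcs)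
    {x : M.Tuple (L.funcDom f)} (hx : ∀ i, x i ∈ D (L.funcDom f i)) :
    M.func f x ∈ _root_.closure (D (L.funcCod f)) := by
  rw [Metric.mem_closure_iff]
  intro ε hε
  let φ : BasicFormula L (Fin.cons (L.funcCod f) (L.funcDom f) : Fin (_ + 1) → L.Sorts) :=
    .dist (Term.lift (L.funcCod f) (.app f fun i => .var i))
      (Term.var (c := (Fin.cons (L.funcCod f) (L.funcDom f) : Fin (_ + 1) → L.Sorts)) 0)
  have hφ : ∀ y, φ.eval M (M.consTuple y x) = dist (M.func f x) y := fun y => by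
    simp only [φ, BasicFormula.eval, Term.eval_lift]
    rfl
  obtain ⟨y, hy, h⟩ := hD _ _ _ φ x hx ε ⟨M.func f x, by rwa [hφ, dist_self]⟩
  exact ⟨y, hy, by rwa [hφ] at h⟩

/-- The closure of a family that satisfies the Tarski–Vaught condition, as a structure. -/
def MetricStructure.TarskiVaught.substructure {M : MetricStructure.{u, v} L}
    {D : ∀ s, Set (M.carrier s)} (hD : M.TarskiVaught D) : MetricStructure.{u, v} L where
  carrier s := _root_.closure (D s)
  metric _ := inferInstance
  complete _ := isClosed_closure.completeSpace_coe
  nonempty s := (hD.nonempty s).closure.to_subtype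
  dist_le s a b := M.dist_le s a.1 b.1
  func f a := ⟨M.func f fun i => a i, closure_closure (s := D (L.funcCod f)) ▸
    hD.closure.func_mem f fun i => (a i).2⟩
  func_unif f ε hε _ _ h := M.func_unif f ε hε _ _ h
  rel R a := M.rel R fun i => a i
  rel_le R _ := M.rel_le R _
  rel_unif R ε hε _ _ h := M.rel_unif R ε hε _ _ h

theorem MetricStructure.TarskiVaught.eval_term {M : MetricStructure.{u, v} L}
    {D : ∀ s, Set (M.carrier s)} (hD : M.TarskiVaught D) {n : ℕ} {c : Fin n → L.Sorts}
    {s : L.Sorts} (t : Term L c s) (x : hD.substructure.Tuple c) :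
    (t.eval hD.substructure x).1 = t.eval M fun i => (x i).1 := by
  induction t with
  | var i => rfl
  | app f ts ih =>
    simp only [Term.eval, ← ih]
    rfl

theorem MetricStructure.TarskiVaught.coe_consTuple {M : MetricStructure.{u, v} L}
    {D : ∀ s, Set (M.carrier s)} (hD : M.TarskiVaught D) {n : ℕ} {c : Fin n → L.Sorts}
    {s : L.Sorts} (b : hD.substructure.carrier s) (x : hD.substructure.Tuple c) :
    (fun i => (hD.substructure.consTuple b x i).1) = M.consTuple b.1 fun i => (x i).1 := by
  funext i
  induction i using Fin.cases with
  | zero => rfl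
  | succ i => rfl

/-- Tarski–Vaught for the closures supplies the witnesses for infima; for suprema it is applied to
the negated formula. -/
theorem MetricStructure.TarskiVaught.eval_substructure {M : MetricStructure.{u, v} L}
    {D : ∀ s, Set (M.carrier s)} (hD : M.TarskiVaught D) {n : ℕ} {c : Fin n → L.Sorts}
    (φ : BasicFormula L c) (x : hD.substructure.Tuple c) :
    φ.eval hD.substructure x = φ.eval M fun i => (x i).1 := by
  induction φ with
  | rel R ts =>
    simp only [BasicFormula.eval, ← hD.eval_term]
    rfl
  | dist t₁ t₂ =>
    simp only [BasicFormula.eval, ← hD.eval_term]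
    rfl
  | conn f φ ih => simp only [BasicFormula.eval, ih]
  | sup s φ ih =>
    refine eq_of_forall_lt_iff fun r => ?_
    rw [BasicFormula.lt_eval_sup, BasicFormula.lt_eval_sup]
    simp only [ih, hD.coe_consTuple]
    refine ⟨fun ⟨b, hb⟩ => ⟨b.1, hb⟩, fun ⟨b, hb⟩ => ?_⟩
    obtain ⟨ψ, hψ⟩ := (φ.isFormulaFun.{u, v}.comp continuous_neg).exists_basic
    obtain ⟨y, hy, hyr⟩ := hD.closure _ _ _ ψ (fun i => (x i).1) (fun i => (x i).2) (-r)
      ⟨b, by rwa [hψ, neg_lt_neg_iff]⟩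
    rw [hψ, neg_lt_neg_iff] at hyr
    exact ⟨⟨y, hy⟩, hyr⟩
  | inf s φ ih =>
    refine eq_of_forall_gt_iff fun r => ?_
    rw [BasicFormula.eval_inf_lt, BasicFormula.eval_inf_lt]
    simp only [ih, hD.coe_consTuple]
    refine ⟨fun ⟨b, hb⟩ => ⟨b.1, hb⟩, fun ⟨b, hb⟩ => ?_⟩
    obtain ⟨y, hy, hyr⟩ := hD.closure _ _ _ φ (fun i => (x i).1) (fun i => (x i).2) r ⟨b, hb⟩
    exact ⟨⟨y, hy⟩, hyr⟩

theorem MetricStructure.TarskiVaught.elemEquiv {M : MetricStructure.{u, v} L}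
    {D : ∀ s, Set (M.carrier s)} (hD : M.TarskiVaught D) : hD.substructure.ElemEquiv M :=
  MetricStructure.elemEquiv_iff.2 fun φ x y => by
    rw [hD.eval_substructure, Subsingleton.elim (fun i => (x i).1) y]

theorem MetricStructure.TarskiVaught.isSeparable {M : MetricStructure.{u, v} L}
    {D : ∀ s, Set (M.carrier s)} (hD : M.TarskiVaught D) (h : ∀ s, (D s).Countable) :
    hD.substructure.IsSeparable :=
  hD.substructure.isSeparable_iff.2 fun s => (h s).isSeparable.closure.separableSpace

theorem MetricStructure.ElemEquiv.value_eq {M N : MetricStructure.{u, v} L} (h : M.ElemEquiv N)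
    (φ : Sentence.{u, v} L) : M.value φ = N.value φ :=
  congrFun (MetricStructure.tp_eq_iff.2 fun φ => MetricStructure.elemEquiv_iff.1 h φ _ _) φ

theorem MetricStructure.ElemEquiv.mem_mod {M N : MetricStructure.{u, v} L} (h : M.ElemEquiv N)
    {T : Set (Sentence.{u, v} L)} (hN : N ∈ Mod T) : M ∈ Mod T :=
  fun φ hφ => (h.value_eq φ).trans (hN φ hφ)

/-! ## Separable languages -/

/-- A countable uniformly dense family of basic formulas. -/
def IsDenseFamily (Φ : ∀ {n : ℕ} (c : Fin n → L.Sorts), Set (BasicFormula L c)) : Prop :=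
  (∀ {n : ℕ} (c : Fin n → L.Sorts), (Φ c).Countable) ∧
    ∀ {n : ℕ} (c : Fin n → L.Sorts) (φ : BasicFormula L c), ∀ ε > 0, ∃ θ ∈ Φ c,
      ∀ (M : MetricStructure.{u, v} L) (a : M.Tuple c), |φ.eval M a - θ.eval M a| < ε

/-- Every formula space is non-empty, so each variable context contributes at least 1 to the sum;
contexts with one variable already exhaust the sorts. -/
theorem IsSeparable.countable_sorts (h : IsSeparable.{u, v} L) : Countable L.Sorts := by
  have h1 : Cardinal.mk (Σ n : ℕ, Fin n → L.Sorts) ≤ Cardinal.aleph0 := by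
    rw [← show languageDensity (∅ : Set (Sentence.{u, v} L)) = Cardinal.aleph0 from h,
      ← mul_one (Cardinal.mk _), ← Cardinal.sum_const']
    refine Cardinal.sum_le_sum _ _ fun c => ?_
    rw [Cardinal.one_le_iff_ne_zero]
    intro h0
    obtain ⟨s, hs, hc⟩ : densityCharacter (TFormula (∅ : Set (Sentence.{u, v} L)) c.2) ∈
        {κ : Cardinal.{u} | ∃ s : Set (TFormula (∅ : Set (Sentence.{u, v} L)) c.2),
          Dense s ∧ Cardinal.mk s = κ} := csInf_mem ⟨_, univ, dense_univ, rfl⟩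
    rw [h0, Cardinal.mk_eq_zero_iff] at hc
    have φ : BasicForm (Mod (∅ : Set (Sentence.{u, v} L))) c.2 :=
      (BasicFormula.conn (k := 0) ⟨fun _ => 0, continuous_const⟩ fun i => i.elim0 :
        BasicFormula L c.2)
    have : Nonempty (TFormula (∅ : Set (Sentence.{u, v} L)) c.2) := ⟨(φ : Completion _)⟩
    exact hs.nonempty.ne_empty (Set.isEmpty_coe_sort.1 hc)
  have h2 : Countable (Σ n : ℕ, Fin n → L.Sorts) := Cardinal.mk_le_aleph0_iff.1 h1
  refine Function.Injective.countable
    (f := fun s => (⟨1, fun _ => s⟩ : Σ n : ℕ, Fin n → L.Sorts)) fun s t hst => ?_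
  have := eq_of_heq (Sigma.mk.inj hst).2
  exact congrFun this 0

/-- A dense subset of the completion may contain no basic formula. A separable metric completion is
second countable, though, and this passes to the basic formulas along the inducing map. -/
theorem IsSeparable.exists_dense_set (h : IsSeparable.{u, v} L) {n : ℕ} (c : Fin n → L.Sorts) :
    ∃ Φ : Set (BasicFormula L c), Φ.Countable ∧ ∀ φ : BasicFormula L c, ∀ ε > 0, ∃ θ ∈ Φ,
      ∀ (M : MetricStructure.{u, v} L) (a : M.Tuple c), |φ.eval M a - θ.eval M a| < ε := by
  have h1 : densityCharacter (TFormula (∅ : Set (Sentence.{u, v} L)) c) ≤ Cardinal.aleph0 := by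
    rw [← show languageDensity (∅ : Set (Sentence.{u, v} L)) = Cardinal.aleph0 from h]
    exact Cardinal.le_sum
      (fun c : (Σ n : ℕ, Fin n → L.Sorts) => densityCharacter (TFormula
        (∅ : Set (Sentence.{u, v} L)) c.2)) ⟨n, c⟩
  have h2 := densityCharacter_le_aleph0_iff.1 h1
  have h3 : SecondCountableTopology (TFormula (∅ : Set (Sentence.{u, v} L)) c) :=
    UniformSpace.secondCountable_of_separable _
  have h4 : SecondCountableTopology (BasicForm (Mod (∅ : Set (Sentence.{u, v} L))) c) :=
    (Completion.isUniformInducing_coe _).isInducing.secondCountableTopology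
  obtain ⟨Φ, hΦ, hd⟩ := TopologicalSpace.exists_countable_dense
    (BasicForm (Mod (∅ : Set (Sentence.{u, v} L))) c)
  refine ⟨Φ, hΦ, fun φ ε hε => ?_⟩
  obtain ⟨θ, hθ, hd⟩ := hd.exists_dist_lt (show BasicForm (Mod ∅) c from φ) hε
  exact ⟨θ, hθ, fun M a => (le_sSup_gapSet φ θ (K := Mod (∅ : Set (Sentence.{u, v} L)))
    (fun ψ hψ => hψ.elim) a).trans_lt hd⟩

theorem IsSeparable.exists_isDenseFamily (h : IsSeparable.{u, v} L) :
    ∃ Φ : ∀ {n : ℕ} (c : Fin n → L.Sorts), Set (BasicFormula L c),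
      IsDenseFamily.{u, v} Φ := by
  choose Φ hΦ using fun (n : ℕ) (c : Fin n → L.Sorts) => h.exists_dense_set c
  exact ⟨fun {n} c => Φ n c, fun c => (hΦ _ c).1, fun c => (hΦ _ c).2⟩

/-- A supremum over the models of T is at most the supremum over all structures, so uniformly dense
families remain dense relative to T. -/
theorem IsSeparable.languageDensity_le (h : IsSeparable.{u, v} L) (T : Set (Sentence.{u, v} L)) :
    languageDensity T ≤ Cardinal.aleph0 := by
  have := h.countable_sorts
  have h1 : ∀ c : (Σ n : ℕ, Fin n → L.Sorts),
      densityCharacter (TFormula T c.2) ≤ Cardinal.aleph0 := by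
    intro c
    rw [densityCharacter_le_aleph0_iff]
    obtain ⟨Φ, hΦ, hd⟩ := h.exists_dense_set c.2
    have : TopologicalSpace.SeparableSpace (BasicForm (Mod T) c.2) := by
      refine ⟨Φ, hΦ, Metric.dense_iff.2 fun φ ε hε => ?_⟩
      obtain ⟨θ, hθ, hlt⟩ := hd φ (ε / 2) (half_pos hε)
      refine ⟨θ, ?_, hθ⟩
      refine Metric.mem_ball'.2 ?_
      refine (Real.sSup_le ?_ (half_pos hε).le).trans_lt (half_lt_self hε)
      rintro _ ⟨M, -, a, rfl⟩
      exact (hlt M a).le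
    infer_instance
  refine (Cardinal.sum_le_sum _ _ h1).trans ?_
  rw [Cardinal.sum_const']
  exact (mul_le_mul' Cardinal.mk_le_aleph0 le_rfl).trans Cardinal.aleph0_mul_aleph0.le

/-- With r - φ(b, x) = 4ε, replacing φ by θ costs ε before and ε after, and q lies between φ(b, x) +
ε and φ(b, x) + 2ε. The slack permits a non-strict bound at the witness. -/
theorem IsDenseFamily.tarskiVaught
    {Φ : ∀ {n : ℕ} (c : Fin n → L.Sorts), Set (BasicFormula L c)} (hΦ : IsDenseFamily.{u, v} Φ)
    {M : MetricStructure.{u, v} L} {D : ∀ s, Set (M.carrier s)}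
    (hD : ∀ (n : ℕ) (c : Fin n → L.Sorts) (s : L.Sorts),
      ∀ φ ∈ Φ (Fin.cons s c : Fin (n + 1) → L.Sorts), ∀ x : M.Tuple c, (∀ i, x i ∈ D (c i)) →
        ∀ q : ℚ, (∃ y, φ.eval M (M.consTuple y x) < q) →
          ∃ y ∈ D s, φ.eval M (M.consTuple y x) ≤ q) : M.TarskiVaught D := by
  rintro n c s φ x hx r ⟨b, hb⟩
  set ε := (r - φ.eval M (M.consTuple b x)) / 4 with hε
  have hε0 : 0 < ε := div_pos (sub_pos.2 hb) (by norm_num)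
  obtain ⟨θ, hθ, hd⟩ := hΦ.2 _ φ ε hε0
  obtain ⟨q, hq1, hq2⟩ := exists_rat_btwn
    (show φ.eval M (M.consTuple b x) + ε < φ.eval M (M.consTuple b x) + 2 * ε by linarith)
  have h1 := abs_lt.1 (hd M (M.consTuple b x))
  obtain ⟨y, hy, hyq⟩ := hD n c s θ hθ x hx q ⟨b, by linarith [h1.1]⟩
  have h2 := abs_lt.1 (hd M (M.consTuple y x))
  exact ⟨y, hy, by linarith [h2.2]⟩

/-- The downward Löwenheim–Skolem theorem. -/
theorem IsSeparable.exists_isSeparable_elemEquiv (hL : IsSeparable.{u, v} L)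
    (M : MetricStructure.{u, v} L) {m : ℕ} {d : Fin m → L.Sorts} (a : M.Tuple d) :
    ∃ N : MetricStructure.{u, v} L, N.IsSeparable ∧ N.ElemEquiv M ∧
      ∃ b : N.Tuple d, N.tp b = M.tp a := by
  classical
  have := hL.countable_sorts
  obtain ⟨Φ, hΦ⟩ := hL.exists_isDenseFamily
  have hw : ∀ (n : ℕ) (c : Fin n → L.Sorts) (s : L.Sorts)
      (φ : BasicFormula L (Fin.cons s c : Fin (n + 1) → L.Sorts)) (q : ℚ) (x : M.Tuple c),
      ∃ w : M.carrier s, (∃ y, φ.eval M (M.consTuple y x) < q) →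
        φ.eval M (M.consTuple w x) < q := by
    intro n c s φ q x
    by_cases h : ∃ y, φ.eval M (M.consTuple y x) < q
    · exact ⟨h.choose, fun _ => h.choose_spec⟩
    · exact ⟨(M.nonempty s).some, fun h' => (h h').elim⟩
  choose w hw using hw
  -- Closing off under the chosen witnesses for countably many formulas and rational bounds keeps
  -- the sets countable; ω rounds suffice, since a finite tuple from the union already appears in
  -- some round.
  let next : (∀ s, Set (M.carrier s)) → ∀ s, Set (M.carrier s) := fun D s =>
    D s ∪ ⋃ (n : ℕ) (c : Fin n → L.Sorts), ⋃ φ ∈ Φ (Fin.cons s c : Fin (n + 1) → L.Sorts),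
      ⋃ q : ℚ, w n c s φ q '' {x | ∀ i, x i ∈ D (c i)}
  let D : ℕ → ∀ s, Set (M.carrier s) := fun k =>
    Nat.rec (fun s => range (M.sortFamily a s)) (fun _ => next) k
  have hcount : ∀ k s, (D k s).Countable := by
    intro k
    induction k with
    | zero => exact fun s => countable_range _
    | succ k ih =>
      intro s
      refine (ih s).union (countable_iUnion fun n => countable_iUnion fun c => (hΦ.1 _).biUnion
        fun φ _ => countable_iUnion fun q => Countable.image ?_ _)
      exact countable_pi fun i => ih (c i)
  have hmono : ∀ s, Monotone fun k => D k s := fun s =>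
    monotone_nat_of_le_succ fun k => subset_union_left
  have hTV : M.TarskiVaught fun s => ⋃ k, D k s := by
    refine hΦ.tarskiVaught fun n c s φ hφ x hx q hy => ?_
    choose k hk using fun i => mem_iUnion.1 (hx i)
    obtain ⟨K, hK⟩ := (finite_range k).bddAbove
    refine ⟨w n c s φ q x, mem_iUnion.2 ⟨K + 1, Or.inr ?_⟩, (hw n c s φ q x hy).le⟩
    simp only [mem_iUnion]
    exact ⟨n, c, φ, hφ, q, x, fun i => hmono _ (hK ⟨i, rfl⟩) (hk i), rfl⟩
  refine ⟨hTV.substructure, hTV.isSeparable fun s => countable_iUnion fun k => hcount k s,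
    hTV.elemEquiv, fun i => ⟨a i, subset_closure (mem_iUnion.2 ⟨0, ⟨⟨i, rfl⟩, rfl⟩⟩)⟩, ?_⟩
  exact MetricStructure.tp_eq_iff.2 fun φ => hTV.eval_substructure φ _

/-! ## Ultrapowers -/

section Ultrapower

open Filter Topology

/-- The limit of a bounded sequence along a fixed non-principal ultrafilter. -/
noncomputable def ulim (f : ℕ → ℝ) : ℝ :=
  limUnder (hyperfilter ℕ : Filter ℕ) f

theorem tendsto_ulim {f : ℕ → ℝ} {B : ℝ} (h : ∀ k, |f k| ≤ B) :
    Tendsto f (hyperfilter ℕ) (𝓝 (ulim f)) := by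
  obtain ⟨x, -, hx⟩ := (isCompact_Icc (a := -B) (b := B)).ultrafilter_le_nhds
    ((hyperfilter ℕ).map f) (le_principal_iff.2 (mem_map.2 (univ_mem' fun k => abs_le.1 (h k))))
  exact tendsto_nhds_limUnder ⟨x, hx⟩

/-- Sequences in a sort of a structure. -/
def MetricStructure.USeq (M : MetricStructure.{u, v} L) (s : L.Sorts) : Type v :=
  ℕ → M.carrier s

variable {M : MetricStructure.{u, v} L}

theorem MetricStructure.tendsto_ulim_dist {s : L.Sorts} (x y : M.USeq s) :
    Tendsto (fun k => dist (x k) (y k)) (hyperfilter ℕ) (𝓝 (ulim fun k => dist (x k) (y k))) :=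
  tendsto_ulim fun k => by
    rw [abs_of_nonneg dist_nonneg]
    exact M.dist_le s (x k) (y k)

noncomputable instance (s : L.Sorts) : PseudoMetricSpace (M.USeq s) where
  dist x y := ulim fun k => dist (x k) (y k)
  dist_self x := tendsto_nhds_unique (M.tendsto_ulim_dist x x) (by simp)
  dist_comm x y := by simp only [dist_comm]
  dist_triangle x y z := le_of_tendsto_of_tendsto' (M.tendsto_ulim_dist x z)
    ((M.tendsto_ulim_dist x y).add (M.tendsto_ulim_dist y z)) fun k => dist_triangle _ _ _

theorem MetricStructure.tendsto_dist {s : L.Sorts} (x y : M.USeq s) :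
    Tendsto (fun k => Dist.dist (x k) (y k)) (hyperfilter ℕ) (𝓝 (Dist.dist x y)) :=
  M.tendsto_ulim_dist x y

theorem MetricStructure.eventually_dist_lt {n : ℕ} {c : Fin n → L.Sorts}
    {x y : ∀ i, M.USeq (c i)} {δ : ℝ} (h : ∀ i, dist (x i) (y i) < δ) :
    ∀ᶠ k in hyperfilter ℕ, ∀ i, dist (x i k) (y i k) < δ :=
  eventually_all.2 fun i => (M.tendsto_dist (x i) (y i)).eventually_lt_const (h i)

/-- A diagonal sequence is a limit: its k-th term comes from `u n` for the largest n ≤ k such that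
the required estimates among u 0, …, u n hold at index k. Completeness of M plays no role. -/
instance (s : L.Sorts) : CompleteSpace (M.USeq s) := by
  classical
  refine Metric.complete_of_convergent_controlled_sequences (fun n => (1 / 2 : ℝ) ^ n)
    (fun n => by positivity) fun u hu => ?_
  let P : ℕ → ℕ → Prop := fun k n =>
    ∀ i ≤ n, ∀ j ≤ n, dist (u i k) (u j k) < (1 / 2 : ℝ) ^ (min i j)
  have hP : ∀ n, ∀ᶠ k in hyperfilter ℕ, P k n := by
    intro n
    refine (eventually_all_finite (finite_Iic n)).2 fun i _ =>
      (eventually_all_finite (finite_Iic n)).2 fun j _ => ?_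
    exact (M.tendsto_dist (u i) (u j)).eventually_lt_const
      (hu _ _ _ (min_le_left i j) (min_le_right i j))
  let y : M.USeq s := fun k => u (Nat.findGreatest (P k) k) k
  have hy : ∀ n, dist (u n) y ≤ (1 / 2 : ℝ) ^ n := by
    intro n
    refine le_of_tendsto (M.tendsto_dist (u n) y) ?_
    filter_upwards [hP n, Nat.hyperfilter_le_atTop (eventually_ge_atTop n)] with k hk hnk
    have h1 : n ≤ Nat.findGreatest (P k) k := Nat.le_findGreatest hnk hk
    have h2 : P k (Nat.findGreatest (P k) k) := Nat.findGreatest_spec hnk hk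
    have h3 := h2 n h1 _ le_rfl
    rw [min_eq_left h1] at h3
    exact h3.le
  refine ⟨y, tendsto_iff_dist_tendsto_zero.2 (squeeze_zero (fun _ => dist_nonneg) hy ?_)⟩
  exact tendsto_pow_atTop_nhds_zero_of_lt_one (by norm_num) (by norm_num)

/-- A sequence that represents an element of the ultrapower. -/
noncomputable def MetricStructure.urep {s : L.Sorts} (x : SeparationQuotient (M.USeq s)) :
    M.USeq s :=
  Function.surjInv SeparationQuotient.surjective_mk x

theorem MetricStructure.mk_urep {s : L.Sorts} (x : SeparationQuotient (M.USeq s)) :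
    SeparationQuotient.mk (M.urep x) = x :=
  Function.surjInv_eq _ x

theorem MetricStructure.dist_urep {s : L.Sorts} (x y : SeparationQuotient (M.USeq s)) :
    dist (M.urep x) (M.urep y) = dist x y := by
  rw [← SeparationQuotient.dist_mk, MetricStructure.mk_urep, MetricStructure.mk_urep]

theorem MetricStructure.tendsto_rel (R : L.Rels) (x : ∀ i, M.USeq (L.relDom R i)) :
    Tendsto (fun k => M.rel R fun i => x i k) (hyperfilter ℕ)
      (𝓝 (ulim fun k => M.rel R fun i => x i k)) :=
  tendsto_ulim fun _ => M.rel_le R _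

/-- The ultrapower of a structure along a non-principal ultrafilter on `ℕ`. -/
noncomputable def MetricStructure.ultrapower (M : MetricStructure.{u, v} L) :
    MetricStructure.{u, v} L where
  carrier s := SeparationQuotient (M.USeq s)
  metric _ := inferInstance
  complete _ := inferInstance
  nonempty s := ⟨SeparationQuotient.mk fun _ => (M.nonempty s).some⟩
  dist_le s a b := by
    rw [← M.dist_urep]
    exact le_of_tendsto' (M.tendsto_dist _ _) fun k => M.dist_le s _ _
  func f a := SeparationQuotient.mk fun k => M.func f fun i => M.urep (a i) k
  func_unif f ε hε a b h := by
    change dist (α := M.USeq (L.funcCod f)) _ _ ≤ _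
    refine le_of_tendsto (M.tendsto_dist _ _) ?_
    filter_upwards [M.eventually_dist_lt fun i => (M.dist_urep (a i) (b i)).trans_lt (h i)]
      with k hk
    exact M.func_unif f ε hε _ _ hk
  rel R a := ulim fun k => M.rel R fun i => M.urep (a i) k
  rel_le R a := le_of_tendsto' (M.tendsto_rel R fun i => M.urep (a i)).abs fun k => M.rel_le R _
  rel_unif R ε hε a b h := by
    refine le_of_tendsto ((M.tendsto_rel R fun i => M.urep (a i)).dist
      (M.tendsto_rel R fun i => M.urep (b i))) ?_
    filter_upwards [M.eventually_dist_lt fun i => (M.dist_urep (a i) (b i)).trans_lt (h i)]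
      with k hk
    exact M.rel_unif R ε hε _ _ hk

/-- The element of the ultrapower given by a sequence. -/
noncomputable def MetricStructure.umk {s : L.Sorts} (x : ℕ → M.carrier s) : M.ultrapower.carrier s :=
  SeparationQuotient.mk (show M.USeq s from x)

theorem MetricStructure.tendsto_dist_umk {s : L.Sorts} (x y : ℕ → M.carrier s) :
    Tendsto (fun k => dist (x k) (y k)) (hyperfilter ℕ) (𝓝 (dist (M.umk x) (M.umk y))) :=
  M.tendsto_dist x y

theorem MetricStructure.exists_umk {s : L.Sorts} (x : M.ultrapower.carrier s) :
    ∃ y : ℕ → M.carrier s, M.umk y = x :=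
  ⟨M.urep x, M.mk_urep x⟩

theorem MetricStructure.dist_urep_umk {s : L.Sorts} (x : M.USeq s) :
    dist (M.urep (M.umk x)) x = 0 := by
  have h := M.mk_urep (M.umk x)
  exact (SeparationQuotient.dist_mk _ _).symm.trans ((congrArg (dist · (M.umk x)) h).trans
    (dist_self _))

/-- The function is defined through chosen representatives. These have ultralimit distance 0 from
the given sequences, and the modulus of f carries this over to the values. -/
theorem MetricStructure.func_umk (f : L.Funcs) (x : ∀ i, ℕ → M.carrier (L.funcDom f i)) :
    M.ultrapower.func f (fun i => M.umk (x i)) = M.umk fun k => M.func f fun i => x i k := by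
  refine eq_of_dist_eq_zero (le_antisymm (le_of_forall_pos_le_add fun ε hε => ?_) dist_nonneg)
  obtain ⟨δ, hδ, h⟩ := MetricStructure.func_uniform.{u, v} f hε
  rw [zero_add]
  refine le_of_tendsto (M.tendsto_dist_umk _ _) ?_
  filter_upwards [M.eventually_dist_lt fun i => (M.dist_urep_umk (x i)).trans_lt hδ] with k hk
  exact h M _ _ hk

theorem MetricStructure.tendsto_rel_umk (R : L.Rels) (x : ∀ i, ℕ → M.carrier (L.relDom R i)) :
    Tendsto (fun k => M.rel R fun i => x i k) (hyperfilter ℕ)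
      (𝓝 (M.ultrapower.rel R fun i => M.umk (x i))) := by
  have h1 := M.tendsto_rel R x
  have h2 := M.tendsto_rel R fun i => M.urep (M.umk (x i))
  have : M.ultrapower.rel R (fun i => M.umk (x i)) = ulim fun k => M.rel R fun i => x i k := by
    refine eq_of_dist_eq_zero (le_antisymm (le_of_forall_pos_le_add fun ε hε => ?_) dist_nonneg)
    obtain ⟨δ, hδ, h⟩ := MetricStructure.rel_uniform.{u, v} R hε
    rw [zero_add]
    refine le_of_tendsto (h2.dist h1) ?_
    filter_upwards [M.eventually_dist_lt fun i => (M.dist_urep_umk (x i)).trans_lt hδ] with k hk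
    exact h M _ _ hk
  rwa [this]

theorem MetricStructure.term_umk {n : ℕ} {c : Fin n → L.Sorts} {s : L.Sorts} (t : Term L c s)
    (x : ∀ i, ℕ → M.carrier (c i)) :
    t.eval M.ultrapower (fun i => M.umk (x i)) = M.umk fun k => t.eval M fun i => x i k := by
  induction t with
  | var i => rfl
  | app f ts ih => simp only [Term.eval, ih, M.func_umk]

/-- A tuple of sequences with a new first entry. -/
def MetricStructure.consSeq (M : MetricStructure.{u, v} L) {n : ℕ} {c : Fin n → L.Sorts}
    {s : L.Sorts} (y : ℕ → M.carrier s) (x : ∀ i, ℕ → M.carrier (c i)) (i : Fin (n + 1)) (k : ℕ) :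
    M.carrier ((Fin.cons s c : Fin (n + 1) → L.Sorts) i) :=
  M.consTuple (y k) (fun i => x i k) i

theorem MetricStructure.umk_consSeq {n : ℕ} {c : Fin n → L.Sorts} {s : L.Sorts}
    (y : ℕ → M.carrier s) (x : ∀ i, ℕ → M.carrier (c i)) :
    (fun i => M.umk (M.consSeq y x i)) =
      M.ultrapower.consTuple (M.umk y) fun i => M.umk (x i) := by
  funext i
  induction i using Fin.cases with
  | zero => rfl
  | succ i => rfl

theorem BasicFormula.abs_eval_le {n : ℕ} {c : Fin n → L.Sorts} (φ : BasicFormula L c)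
    (M : MetricStructure.{u, v} L) : ∃ B, ∀ a, |φ.eval M a| ≤ B := by
  obtain ⟨B, hB⟩ := BasicFormula.exists_bound.{u, v} φ
  exact ⟨B, hB M⟩

/-- Łoś's theorem. -/
theorem MetricStructure.tendsto_eval_umk {n : ℕ} {c : Fin n → L.Sorts} (φ : BasicFormula L c)
    (x : ∀ i, ℕ → M.carrier (c i)) :
    Tendsto (fun k => φ.eval M fun i => x i k) (hyperfilter ℕ)
      (𝓝 (φ.eval M.ultrapower fun i => M.umk (x i))) := by
  induction φ with
  | rel R ts =>
    simp only [BasicFormula.eval, M.term_umk]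
    exact M.tendsto_rel_umk R _
  | dist t₁ t₂ =>
    simp only [BasicFormula.eval, M.term_umk]
    exact M.tendsto_dist_umk _ _
  | conn f φ ih =>
    exact f.continuous.continuousAt.tendsto.comp (tendsto_pi_nhds.2 fun i => ih i x)
  | @sup n c s φ ih =>
    obtain ⟨B, hB⟩ := (BasicFormula.sup s φ).abs_eval_le M
    have hl := tendsto_ulim fun k => hB fun i => x i k
    convert hl using 2
    refine eq_of_forall_lt_iff fun r => ⟨fun hr => ?_, fun hr => ?_⟩
    · obtain ⟨r', hr', hr⟩ := exists_between hr
      obtain ⟨b, hb⟩ := (φ.lt_eval_sup _ _ _).1 hr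
      obtain ⟨y, rfl⟩ := M.exists_umk b
      rw [← M.umk_consSeq] at hb
      refine hr'.trans_le (ge_of_tendsto hl ?_)
      filter_upwards [(ih (M.consSeq y x)).eventually_const_lt hb] with k hk
      exact ((φ.lt_eval_sup _ _ _).2 ⟨y k, hk⟩).le
    · obtain ⟨r', hr', hr⟩ := exists_between hr
      -- Witnesses exist for almost all k; an arbitrary element is used elsewhere. The intermediate
      -- numbers restore strictness, as passing to the limit only gives ≤.
      have hy : ∀ k, ∃ y, r' < (BasicFormula.sup s φ).eval M (fun i => x i k) →
          r' < φ.eval M (M.consTuple y fun i => x i k) := by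
        intro k
        by_cases h : r' < (BasicFormula.sup s φ).eval M (fun i => x i k)
        · exact ((φ.lt_eval_sup _ _ _).1 h).imp fun _ h _ => h
        · exact ⟨(M.nonempty s).some, fun h' => (h h').elim⟩
      choose y hy using hy
      obtain ⟨r'', hr'', hr'⟩ := exists_between hr'
      refine (φ.lt_eval_sup _ _ _).2 ⟨M.umk y, ?_⟩
      rw [← M.umk_consSeq]
      refine hr''.trans_le (ge_of_tendsto (ih (M.consSeq y x)) ?_)
      filter_upwards [hl.eventually_const_lt hr] with k hk
      exact (hr'.trans (hy k hk)).le
  | @inf n c s φ ih =>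
    obtain ⟨B, hB⟩ := (BasicFormula.inf s φ).abs_eval_le M
    have hl := tendsto_ulim fun k => hB fun i => x i k
    convert hl using 2
    refine eq_of_forall_gt_iff fun r => ⟨fun hr => ?_, fun hr => ?_⟩
    · obtain ⟨r', hr, hr'⟩ := exists_between hr
      obtain ⟨b, hb⟩ := (φ.eval_inf_lt _ _ _).1 hr
      obtain ⟨y, rfl⟩ := M.exists_umk b
      rw [← M.umk_consSeq] at hb
      refine (le_of_tendsto hl ?_).trans_lt hr'
      filter_upwards [(ih (M.consSeq y x)).eventually_lt_const hb] with k hk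
      exact ((φ.eval_inf_lt _ _ _).2 ⟨y k, hk⟩).le
    · obtain ⟨r', hr, hr'⟩ := exists_between hr
      have hy : ∀ k, ∃ y, (BasicFormula.inf s φ).eval M (fun i => x i k) < r' →
          φ.eval M (M.consTuple y fun i => x i k) < r' := by
        intro k
        by_cases h : (BasicFormula.inf s φ).eval M (fun i => x i k) < r'
        · exact ((φ.eval_inf_lt _ _ _).1 h).imp fun _ h _ => h
        · exact ⟨(M.nonempty s).some, fun h' => (h h').elim⟩
      choose y hy using hy
      obtain ⟨r'', hr', hr''⟩ := exists_between hr'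
      refine (φ.eval_inf_lt _ _ _).2 ⟨M.umk y, ?_⟩
      rw [← M.umk_consSeq]
      refine (le_of_tendsto (ih (M.consSeq y x)) ?_).trans_lt hr''
      filter_upwards [hl.eventually_lt_const hr] with k hk
      exact ((hy k hk).trans hr').le

theorem MetricStructure.ultrapower_elemEquiv (M : MetricStructure.{u, v} L) :
    M.ultrapower.ElemEquiv M :=
  MetricStructure.elemEquiv_iff.2 fun φ x y => by
    have := M.tendsto_eval_umk φ fun i => i.elim0
    rw [Subsingleton.elim x fun i => M.umk i.elim0, Subsingleton.elim y fun i => i.elim0]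
    exact tendsto_nhds_unique this
      (tendsto_const_nhds.congr fun k => congrArg _ (Subsingleton.elim _ _))

end Ultrapower

/-! ## A criterion for principal types -/

section Principal

open Filter Topology

/-- A function on the structures in `K` that is uniformly approximated by basic formulas is given
by a formula. -/
theorem Form.exists_of_approx {K : Set (MetricStructure.{u, v} L)} {n : ℕ} {c : Fin n → L.Sorts}
    (G : ∀ M : K, M.1.Tuple c → ℝ)
    (hG : ∀ ε > 0, ∃ θ : BasicFormula L c, ∀ (M : K) (a : M.1.Tuple c),
      |θ.eval M.1 a - G M a| ≤ ε) :
    ∃ D : Form K c, ∀ (M : K) (a : M.1.Tuple c), Form.eval M a D = G M a := by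
  choose θ hθ using fun k : ℕ => hG (1 / (k + 1)) Nat.one_div_pos_of_nat
  let θ' : ℕ → BasicForm K c := θ
  have hlim : Tendsto (fun k : ℕ => 2 * (1 / ((k : ℝ) + 1))) atTop (𝓝 0) := by
    simpa using tendsto_one_div_add_atTop_nhds_zero_nat.const_mul (2 : ℝ)
  have hle : ∀ k N : ℕ, N ≤ k → 1 / ((k : ℝ) + 1) ≤ 1 / ((N : ℝ) + 1) := fun k N h =>
    one_div_le_one_div_of_le (by positivity) (by gcongr)
  have hc : CauchySeq fun k => (θ' k : Form K c) := by
    refine cauchySeq_of_le_tendsto_0 _ (fun j k N hj hk => ?_) hlim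
    rw [Completion.dist_eq]
    refine Real.sSup_le ?_ (by positivity)
    rintro _ ⟨M, hM, a, rfl⟩
    have h1 := hθ j ⟨M, hM⟩ a
    have h2 := hθ k ⟨M, hM⟩ a
    rw [abs_sub_comm] at h2
    have := abs_sub_le ((θ j).eval M a) (G ⟨M, hM⟩ a) ((θ k).eval M a)
    linarith [hle j N hj, hle k N hk]
  obtain ⟨D, hD⟩ := cauchySeq_tendsto_of_complete hc
  refine ⟨D, fun M a => ?_⟩
  have h1 : Tendsto (fun k => Form.eval M a (θ' k : Form K c)) atTop
      (𝓝 (Form.eval M a D)) :=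
    (Completion.continuous_extension.tendsto D).comp hD
  have h2 : Tendsto (fun k => (θ k).eval M.1 a) atTop (𝓝 (G M a)) := by
    refine tendsto_iff_dist_tendsto_zero.2 (squeeze_zero (fun _ => dist_nonneg)
      (fun k => ?_) tendsto_one_div_add_atTop_nhds_zero_nat)
    exact hθ k M a
  refine tendsto_nhds_unique h1 (h2.congr fun k => (Form.eval_coe M a _).symm)

variable {n : ℕ} {d : Fin n → L.Sorts} {M₀ : MetricStructure.{u, v} L} {a₀ : M₀.Tuple d}

/-- The type of `a₀` is approximately realized at distance less than `ε` from `a`. -/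
def MetricStructure.NearType (M₀ : MetricStructure.{u, v} L) (a₀ : M₀.Tuple d) (ε : ℝ)
    (M : MetricStructure.{u, v} L) (a : M.Tuple d) : Prop :=
  ∀ ψ : BasicFormula L d, ψ.eval M₀ a₀ = 0 → ∀ η > 0, ∃ y : M.Tuple d,
    dist a y < ε ∧ |ψ.eval M y| < η

/-- Every metric neighbourhood of the type of `a₀` contains an open condition on it. -/
def MetricStructure.IsIsolated (T : Set (Sentence.{u, v} L)) (M₀ : MetricStructure.{u, v} L)
    (a₀ : M₀.Tuple d) : Prop :=
  ∀ ε > 0, ∃ φ : BasicFormula L d, φ.eval M₀ a₀ < 0 ∧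
    ∀ M ∈ Mod T, ∀ a : M.Tuple d, φ.eval M a < 0 → M₀.NearType a₀ ε M a

/-- The formula φ - φ(a₀) vanishes at a₀, so nearby it can be made smaller in absolute value than
-φ(a₀). -/
theorem MetricStructure.NearType.exists_lt {ε : ℝ} {M : MetricStructure.{u, v} L} {a : M.Tuple d}
    (h : M₀.NearType a₀ ε M a) {φ : BasicFormula L d} (hφ : φ.eval M₀ a₀ < 0) :
    ∃ y : M.Tuple d, dist a y < ε ∧ φ.eval M y < 0 := by
  obtain ⟨ψ, hψ⟩ := (φ.isFormulaFun.{u, v}.comp (f := fun r => r - φ.eval M₀ a₀)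
    (by fun_prop)).exists_basic
  obtain ⟨y, hy, hy'⟩ := h ψ (by rw [hψ, sub_self]) (-φ.eval M₀ a₀) (neg_pos.2 hφ)
  rw [hψ, abs_lt] at hy'
  exact ⟨y, hy, by linarith [hy'.2]⟩

/-- From a point with φ_k < 0 one moves by less than ε/2^(k+1) to a point with φ_(k+1) < 0. These
moves sum to ε, and the limit, which exists by completeness of M, is approached by points that
nearly satisfy any given condition of the type, so it realizes the type. -/
theorem MetricStructure.IsIsolated.exists_realization {T : Set (Sentence.{u, v} L)}
    (h : M₀.IsIsolated T a₀) {ε : ℝ} (hε : 0 < ε) :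
    ∃ φ : BasicFormula L d, φ.eval M₀ a₀ < 0 ∧ ∀ M ∈ Mod T, ∀ a : M.Tuple d, φ.eval M a < 0 →
      ∃ b : M.Tuple d, M.tp b = M₀.tp a₀ ∧ dist a b ≤ ε := by
  choose φ hφ hnear using fun k : ℕ => h (ε / 2 / 2 ^ k) (by positivity)
  refine ⟨φ 0, hφ 0, fun M hM a ha => ?_⟩
  have hstep : ∀ k (x : {x : M.Tuple d // (φ k).eval M x < 0}),
      ∃ y : {x : M.Tuple d // (φ (k + 1)).eval M x < 0}, dist x.1 y.1 < ε / 2 / 2 ^ k := by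
    rintro k ⟨x, hx⟩
    obtain ⟨y, hy, hy'⟩ := (hnear k M hM x hx).exists_lt (hφ (k + 1))
    exact ⟨⟨y, hy'⟩, hy⟩
  choose next hnext using hstep
  let x : ∀ k, {x : M.Tuple d // (φ k).eval M x < 0} := fun k => Nat.rec ⟨a, ha⟩ next k
  have hx : ∀ k, dist (x k).1 (x (k + 1)).1 ≤ ε / 2 / 2 ^ k := fun k => (hnext k (x k)).le
  obtain ⟨b, hb⟩ := cauchySeq_tendsto_of_complete (cauchySeq_of_le_geometric_two hx)
  refine ⟨b, MetricStructure.tp_eq_iff.2 fun ψ => ?_, dist_le_of_le_geometric_two_of_tendsto₀ hx hb⟩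
  obtain ⟨ψ', hψ'⟩ := (ψ.isFormulaFun.{u, v}.comp (f := fun r => r - ψ.eval M₀ a₀)
    (by fun_prop)).exists_basic
  choose y hy hy' using fun k : ℕ => hnear k M hM (x k).1 (x k).2 ψ' (by rw [hψ', sub_self])
    (1 / (k + 1)) Nat.one_div_pos_of_nat
  have hyb : Tendsto y atTop (𝓝 b) := by
    refine (tendsto_iff_of_dist (squeeze_zero (fun _ => dist_nonneg) (fun k => (hy k).le) ?_)).1 hb
    have := (tendsto_pow_atTop_nhds_zero_of_lt_one (r := (1 / 2 : ℝ)) (by norm_num)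
      (by norm_num)).const_mul (ε / 2)
    rw [mul_zero] at this
    refine this.congr fun k => ?_
    rw [one_div_pow, mul_one_div]
  have h1 := ((ψ'.continuous_eval M).tendsto b).comp hyb
  have h2 : Tendsto (fun k => ψ'.eval M (y k)) atTop (𝓝 0) :=
    squeeze_zero_norm (fun k => (hy' k).le) tendsto_one_div_add_atTop_nhds_zero_nat
  have h3 := tendsto_nhds_unique h1 h2
  rw [hψ'] at h3
  linarith

theorem MetricStructure.dist_le_sum (M : MetricStructure.{u, v} L) (x y : M.Tuple d) :
    dist x y ≤ ∑ i, L.sortBound (d i) :=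
  (dist_pi_le_iff (Finset.sum_nonneg fun _ _ => (L.sortBound_pos _).le)).2 fun i =>
    (M.dist_le _ _ _).trans (Finset.single_le_sum (f := fun i => L.sortBound (d i))
      (fun _ _ => (L.sortBound_pos _).le) (Finset.mem_univ i))

/-- Up to ε, the distance from x to the type is inf_y (d(x, y) + B/(-r) · max(φ(y) - r, 0)) with r =
φ(a₀) < 0. Realizations y pay no penalty; points with φ(y) < 0 are ε-close to a realization; all
others pay at least B, which bounds every distance. -/
theorem MetricStructure.IsIsolated.isPrincipal {T : Set (Sentence.{u, v} L)}
    (hT : IsCompleteTheory T) (hM₀ : M₀ ∈ Mod T) (h : M₀.IsIsolated T a₀) :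
    IsPrincipal T (M₀.tp a₀) := by
  refine Form.exists_of_approx
    (fun (M : Mod T) a => M.1.distTo a (M.1.realizations (M₀.tp a₀))) fun ε hε => ?_
  obtain ⟨φ, hφ, hreal⟩ := h.exists_realization hε
  set r := φ.eval M₀ a₀ with hr
  set B := ∑ i, L.sortBound (d i) with hB
  have hB0 : 0 ≤ B := Finset.sum_nonneg fun i _ => (L.sortBound_pos _).le
  obtain ⟨θ, hθ⟩ := IsFormulaFun.exists_inf (c := d) (d := d)
    (F := fun M x y => dist x y + B / (-r) * max (φ.eval M y - r) 0)
    (((IsFormulaFun.tupleDist (fun i => .var _ (Sum.inl i)) fun i => .var _ (Sum.inr i)).comp₂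
      ((φ.isFormulaFun.subst fun i => .var _ (Sum.inr i)).comp
        (f := fun t => B / (-r) * max (t - r) 0) (by fun_prop))
      (f := fun s t => s + t) (by fun_prop)))
  refine ⟨θ, fun M a => ?_⟩
  -- Completeness of T carries the open condition φ < 0 from M₀ to M, so the type is realized in
  -- every model and the empty-set convention does not enter.
  have hne : (M.1.realizations (M₀.tp a₀)).Nonempty := by
    obtain ⟨a, ha⟩ := (hT.2 M₀ hM₀ M.1 M.2).exists_lt φ.isFormulaFun ⟨a₀, hφ⟩
    obtain ⟨b, hb, -⟩ := hreal M.1 M.2 a ha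
    exact ⟨b, hb⟩
  rw [MetricStructure.distTo, if_pos hne, abs_le]
  constructor
  · have : Metric.infDist a (M.1.realizations (M₀.tp a₀)) - ε ≤ θ.eval M.1 a := by
      refine le_of_forall_gt fun s hs => ?_
      obtain ⟨y, hy⟩ := (hθ M.1 a s).1 hs
      rcases lt_or_ge (φ.eval M.1 y) 0 with hneg | hnn
      · obtain ⟨b, hb, hyb⟩ := hreal M.1 M.2 y hneg
        have h1 := Metric.infDist_le_dist_of_mem (x := a) (s := M.1.realizations (M₀.tp a₀)) hb
        have h2 : 0 ≤ B / (-r) * max (φ.eval M.1 y - r) 0 :=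
          mul_nonneg (div_nonneg hB0 (by linarith)) (le_max_right _ _)
        linarith [dist_triangle a y b]
      · obtain ⟨b, hb⟩ := hne
        have h1 := Metric.infDist_le_dist_of_mem (x := a) (s := M.1.realizations (M₀.tp a₀)) hb
        have h2 : B ≤ B / (-r) * max (φ.eval M.1 y - r) 0 := by
          have hr0 : -r ≠ 0 := (neg_pos.2 hφ).ne'
          calc B = B / (-r) * (-r) := (div_mul_cancel₀ B hr0).symm
            _ ≤ _ := by
              refine mul_le_mul_of_nonneg_left ((?_ : -r ≤ _).trans (le_max_left _ _))
                (div_nonneg hB0 (by linarith))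
              linarith
        have h3 := M.1.dist_le_sum a b
        linarith [dist_nonneg (x := a) (y := y)]
    linarith
  · have : θ.eval M.1 a ≤ Metric.infDist a (M.1.realizations (M₀.tp a₀)) := by
      refine le_of_forall_gt_imp_ge_of_dense fun s hs => ?_
      obtain ⟨y, hy, hys⟩ := (Metric.infDist_lt_iff hne).1 hs
      refine ((hθ M.1 a s).2 ⟨y, ?_⟩).le
      rw [MetricStructure.tp_eq_iff.1 hy φ, sub_self, max_self, mul_zero, add_zero]
      exact hys
    linarith

/-- If the type of `a₀` is not isolated, then a satisfiable open condition is satisfied somewhere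
away from the type. -/
theorem MetricStructure.exists_not_nearType {T : Set (Sentence.{u, v} L)}
    (h : ¬ M₀.IsIsolated T a₀) : ∃ ε > 0, ∀ {J : Type} {τ : J → L.Sorts}
      {F : ∀ M : MetricStructure.{u, v} L, (∀ j, M.carrier (τ j)) → ℝ} (_ : IsFormulaFun τ F)
      {x : ∀ i, ∀ M : MetricStructure.{u, v} L, (∀ j, M.carrier (τ j)) → M.carrier (d i)}
      (_ : ∀ i, IsTermFun τ (d i) (x i)), (∃ M ∈ Mod T, ∃ A, F M A < 0) →
      ∃ M ∈ Mod T, ∃ A, F M A < 0 ∧ ¬ M₀.NearType a₀ ε M fun i => x i M A := by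
  rw [MetricStructure.IsIsolated] at h
  push Not at h
  obtain ⟨ε, hε, h⟩ := h
  refine ⟨ε / 3, by positivity, fun {J τ F} hF {x} hx hsat => ?_⟩
  by_contra! hcon
  obtain ⟨M₁, hM₁, A₁, hA₁⟩ := hsat
  have hdist : IsFormulaFun (Sum.elim d τ) fun M A => dist (fun i => A (.inl i) : M.Tuple d)
      (fun i => x i M fun j => A (.inr j) : M.Tuple d) := by
    refine .tupleDist (fun i => .var _ (Sum.inl i)) fun i => ?_
    obtain ⟨m, e, t, ht⟩ := hx i
    exact ⟨m, fun k => .inr (e k), t, fun M A => ht M _⟩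
  have hF' : IsFormulaFun (Sum.elim d τ) fun M A => F M fun j => A (.inr j) :=
    hF.subst fun j => .var _ (Sum.inr j)
  -- The condition χ(z) < 0 says that z is within 2ε/3 of x(A) for some A with F(A) < 0. If every
  -- such x(A) were ε/3-near the type, this open condition would hold at a₀ and force ε-nearness,
  -- contrary to the choice of ε.
  obtain ⟨χ, hχ⟩ := IsFormulaFun.exists_inf_family (c := d) (τ := τ)
    (F := fun M z A => max (F M A)
      (dist z (fun i => x i M A : M.Tuple d) - 2 * ε / 3))
    (hF'.comp₂ hdist (f := fun s t => max s (t - 2 * ε / 3)) (by fun_prop))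
  have hχ₀ : χ.eval M₀ a₀ < 0 := by
    by_contra! hge
    obtain ⟨ψ, hψ⟩ := (χ.isFormulaFun.{u, v}.comp (f := fun t => min t 0)
      (by fun_prop)).exists_basic
    -- Points y within ε/3 of x(A₁) satisfy χ(y) < -κ, so min(χ, 0) cannot be made smaller than κ
    -- near x(A₁), although it would vanish at a₀.
    set κ := min (-F M₁ A₁) (ε / 3) / 2 with hκ
    have hκ0 : 0 < κ := half_pos (lt_min (neg_pos.2 hA₁) (by positivity))
    obtain ⟨y, hy, hy'⟩ := hcon M₁ hM₁ A₁ hA₁ ψ (by rw [hψ, min_eq_right hge]) κ hκ0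
    have h1 : χ.eval M₁ y < -κ := by
      refine (hχ _ _ _).2 ⟨A₁, ?_⟩
      rw [dist_comm] at hy
      have e1 := min_le_left (-F M₁ A₁) (ε / 3)
      have e2 := min_le_right (-F M₁ A₁) (ε / 3)
      refine max_lt ?_ ?_ <;> linarith
    rw [hψ, min_eq_left (by linarith), abs_lt] at hy'
    linarith [hy'.1]
  obtain ⟨M, hM, a, ha, hna⟩ := h χ hχ₀
  obtain ⟨A, hA⟩ := (hχ _ _ _).1 ha
  obtain ⟨hA1, hA2⟩ := max_lt_iff.1 hA
  refine hna fun ψ hψ η hη => ?_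
  obtain ⟨y, hy, hy'⟩ := hcon M hM A hA1 ψ hψ η hη
  refine ⟨y, (dist_triangle a (fun i => x i M A : M.Tuple d) y).trans_lt ?_, hy'⟩
  linarith

/-- The previous statement, with the second condition expressed by a formula, and in a prescribed
model. -/
theorem MetricStructure.exists_avoiding {T : Set (Sentence.{u, v} L)} (hT : IsCompleteTheory T)
    (h : ¬ M₀.IsIsolated T a₀) : ∃ ε > 0, ∀ {J : Type} {τ : J → L.Sorts}
      {F : ∀ M : MetricStructure.{u, v} L, (∀ j, M.carrier (τ j)) → ℝ} (_ : IsFormulaFun τ F)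
      {x : ∀ i, ∀ M : MetricStructure.{u, v} L, (∀ j, M.carrier (τ j)) → M.carrier (d i)}
      (_ : ∀ i, IsTermFun τ (d i) (x i)), ∀ M ∈ Mod T, (∃ A, F M A < 0) →
      ∃ G : ∀ M : MetricStructure.{u, v} L, (∀ j, M.carrier (τ j)) → ℝ, IsFormulaFun τ G ∧
        (∃ ψ : BasicFormula L d, ψ.eval M₀ a₀ = 0 ∧ ∃ η > 0, ∀ N A, G N A ≤ 0 →
          ∀ y : N.Tuple d, dist (fun i => x i N A : N.Tuple d) y < ε → η ≤ |ψ.eval N y|) ∧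
        ∃ A, F M A < 0 ∧ G M A < 0 := by
  obtain ⟨ε, hε, h⟩ := MetricStructure.exists_not_nearType h
  refine ⟨ε / 2, half_pos hε, fun {J τ F} hF {x} hx M hM hsat => ?_⟩
  obtain ⟨M₁, hM₁, A₁, hA₁, hn⟩ := h hF hx ⟨M, hM, hsat⟩
  rw [MetricStructure.NearType] at hn
  push Not at hn
  obtain ⟨ψ, hψ, η, hη, hn⟩ := hn
  -- Here χ(z) > 0 excludes points y within ε/2 of z with |ψ(y)| < η/2. At x(A₁) even χ ≥ κ holds,
  -- so G = κ/2 - χ is strictly negative there, which can be transferred to M, while G ≤ 0 is still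
  -- enough for avoidance.
  obtain ⟨χ, hχ⟩ := IsFormulaFun.exists_inf (c := d) (d := d)
    (F := fun M z y => max (dist z y - ε / 2) (|ψ.eval M y| - η / 2))
    ((IsFormulaFun.tupleDist (fun i => .var _ (Sum.inl i)) fun i => .var _ (Sum.inr i)).comp₂
      (ψ.isFormulaFun.subst fun i => .var _ (Sum.inr i))
      (f := fun s t => max (s - ε / 2) (|t| - η / 2)) (by fun_prop))
  set κ := min (ε / 2) (η / 2) with hκ
  have hκ0 : 0 < κ := lt_min (half_pos hε) (half_pos hη)
  have hG : IsFormulaFun τ fun M A => κ / 2 - χ.eval M fun i => x i M A :=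
    (χ.isFormulaFun.subst hx).comp (f := fun t => κ / 2 - t) (by fun_prop)
  refine ⟨_, hG, ⟨ψ, hψ, η / 2, half_pos hη, fun N A hA y hy => ?_⟩, ?_⟩
  · by_contra! hlt
    have : χ.eval N (fun i => x i N A) < 0 :=
      (hχ _ _ _).2 ⟨y, max_lt (by linarith) (by linarith)⟩
    linarith
  · have hχ₁ : κ ≤ χ.eval M₁ fun i => x i M₁ A₁ := by
      by_contra! hlt
      obtain ⟨y, hy⟩ := (hχ _ _ _).1 hlt
      obtain ⟨h1, h2⟩ := max_lt_iff.1 hy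
      have e1 := min_le_left (ε / 2) (η / 2)
      have e2 := min_le_right (ε / 2) (η / 2)
      have := hn y (by linarith)
      linarith
    obtain ⟨A, hA⟩ := (hT.2 M₁ hM₁ M hM).exists_lt (hF.comp₂ hG continuous_max)
      ⟨A₁, max_lt hA₁ (by linarith)⟩
    exact ⟨A, max_lt_iff.1 hA⟩

end Principal

/-! ## Generic families in ultrapowers and omitting types -/

section Generic

open Filter Topology

theorem IsFormulaFun.tendsto_umk {I : Type*} {σ : I → L.Sorts}
    {F : ∀ M : MetricStructure.{u, v} L, (∀ i, M.carrier (σ i)) → ℝ} (hF : IsFormulaFun σ F)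
    {M : MetricStructure.{u, v} L} (x : ∀ i, ℕ → M.carrier (σ i)) :
    Tendsto (fun k => F M fun i => x i k) (hyperfilter ℕ)
      (𝓝 (F M.ultrapower fun i => M.umk (x i))) := by
  obtain ⟨n, e, φ, hφ⟩ := hF
  simp only [hφ]
  exact M.tendsto_eval_umk φ fun j => x (e j)

theorem IsFormulaFun.exists_support {I : Type*} {σ : I → L.Sorts}
    {F : ∀ M : MetricStructure.{u, v} L, (∀ i, M.carrier (σ i)) → ℝ} (hF : IsFormulaFun σ F) :
    ∃ E : Set I, E.Finite ∧ ∀ M A B, (∀ i ∈ E, A i = B i) → F M A = F M B := by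
  obtain ⟨n, e, φ, hφ⟩ := hF
  refine ⟨range e, finite_range e, fun M A B h => ?_⟩
  rw [hφ, hφ]
  congr 1
  funext k
  exact h _ ⟨k, rfl⟩

/-- If each of countably many requirements can be met by shrinking any satisfiable open condition,
then a family in the ultrapower meets all of them. -/
theorem MetricStructure.exists_generic {I ι : Type*} [Countable ι] {σ : I → L.Sorts}
    (M : MetricStructure.{u, v} L)
    (P : ι → (∀ M : MetricStructure.{u, v} L, (∀ i, M.carrier (σ i)) → ℝ) → Prop)
    (hP : ∀ k F, IsFormulaFun σ F → (∃ A, F M A < 0) →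
      ∃ G, IsFormulaFun σ G ∧ P k G ∧ ∃ A, F M A < 0 ∧ G M A < 0) :
    ∃ A : ∀ i, M.ultrapower.carrier (σ i), ∀ k, ∃ G, P k G ∧ G M.ultrapower A ≤ 0 := by
  rcases isEmpty_or_nonempty ι with h | h
  · exact ⟨fun i => (M.ultrapower.nonempty (σ i)).some, fun k => h.elim k⟩
  obtain ⟨g, hg⟩ := exists_surjective_nat ι
  let C := {F : ∀ M : MetricStructure.{u, v} L, (∀ i, M.carrier (σ i)) → ℝ //
    IsFormulaFun σ F ∧ ∃ A, F M A < 0}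
  have hstep : ∀ (k : ℕ) (F : C), ∃ F' : C, (∀ A, F'.1 M A < 0 → F.1 M A < 0) ∧
      ∃ G, IsFormulaFun σ G ∧ P (g k) G ∧ ∀ A, F'.1 M A < 0 → G M A < 0 := by
    rintro k ⟨F, hF, hA⟩
    obtain ⟨G, hG, hPG, A, hFA, hGA⟩ := hP (g k) F hF hA
    exact ⟨⟨_, hF.comp₂ hG continuous_max, A, max_lt hFA hGA⟩,
      fun A h => (max_lt_iff.1 h).1, G, hG, hPG, fun A h => (max_lt_iff.1 h).2⟩
  choose next hnext G hG hPG hGlt using hstep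
  -- A decreasing sequence of satisfiable conditions. The k-th family satisfies all requirements
  -- treated before stage k, so the family of ultralimits satisfies every one of them in the relaxed
  -- form G ≤ 0.
  let F : ℕ → C := fun k => Nat.rec
    ⟨fun _ _ => -1, .const σ (-1), fun i => (M.nonempty (σ i)).some, by norm_num⟩ next k
  choose A hA using fun k => (F k).2.2
  have hmono : ∀ k j B, (F (k + j)).1 M B < 0 → (F k).1 M B < 0 := by
    intro k j
    induction j with
    | zero => exact fun B h => h
    | succ j ih => exact fun B h => ih B (hnext (k + j) (F (k + j)) B h)
  refine ⟨fun i => M.umk fun k => A k i, fun k => ?_⟩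
  obtain ⟨m, rfl⟩ := hg k
  refine ⟨G m (F m), hPG m (F m),
    le_of_tendsto ((hG m (F m)).tendsto_umk fun i k => A k i) ?_⟩
  filter_upwards [Nat.hyperfilter_le_atTop (eventually_ge_atTop (m + 1))] with k hk
  obtain ⟨j, rfl⟩ := Nat.exists_eq_add_of_le hk
  exact (hGlt m (F m) _ (hmono (m + 1) j _ (hA _))).le

theorem MetricStructure.sortFamily_update {M : MetricStructure.{u, v} L} {c : ℕ → L.Sorts}
    {A : ∀ i, M.carrier (c i)} {j : ℕ} (y : M.carrier (c j)) {s : L.Sorts} {i : {i // c i = s}}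
    (h : i.1 ≠ j) :
    M.sortFamily (Function.update A j y) s i = M.sortFamily A s i := by
  obtain ⟨i, rfl⟩ := i
  exact Function.update_of_ne h _ _

theorem IsTermFun.consTuple {I : Type*} {σ : I → L.Sorts} {n : ℕ} {c : Fin n → L.Sorts}
    {s : L.Sorts} {y : ∀ M : MetricStructure.{u, v} L, (∀ i, M.carrier (σ i)) → M.carrier s}
    {x : ∀ k, ∀ M : MetricStructure.{u, v} L, (∀ i, M.carrier (σ i)) → M.carrier (c k)}
    (hy : IsTermFun σ s y) (hx : ∀ k, IsTermFun σ (c k) (x k)) (k : Fin (n + 1)) :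
    IsTermFun σ _ fun M A => M.consTuple (y M A) (fun k => x k M A) k := by
  induction k using Fin.cases with
  | zero => exact hy
  | succ k => exact hx k

/-- A formula with a quantifier over one variable, a choice of the other variables, and two
bounds. -/
def WitnessIndex (Φ : ∀ {n : ℕ} (c : Fin n → L.Sorts), Set (BasicFormula L c))
    (σ : ℕ → L.Sorts) : Type u :=
  Σ (m : ℕ) (c : Fin m → L.Sorts) (s : L.Sorts)
    (_ : Φ (Fin.cons s c : Fin (m + 1) → L.Sorts)) (_ : ∀ k, {j // σ j = c k}),
    {q : ℚ × ℚ // q.1 < q.2}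

theorem IsDenseFamily.countable_witnessIndex [Countable L.Sorts]
    {Φ : ∀ {n : ℕ} (c : Fin n → L.Sorts), Set (BasicFormula L c)} (hΦ : IsDenseFamily.{u, v} Φ)
    (σ : ℕ → L.Sorts) : Countable (WitnessIndex Φ σ) := by
  have : ∀ (m : ℕ) (c : Fin m → L.Sorts), Countable (Φ c) := fun m c => (hΦ.1 c).to_subtype
  unfold WitnessIndex
  infer_instance

/-- If `G ≤ 0`, then the infimum of the formula is at least the smaller bound, or else a member of
the family witnesses that it is at most the larger bound. -/
def WitnessIndex.Decides {Φ : ∀ {n : ℕ} (c : Fin n → L.Sorts), Set (BasicFormula L c)}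
    {σ : ℕ → L.Sorts} (N : MetricStructure.{u, v} L) : WitnessIndex Φ σ →
      (∀ M : MetricStructure.{u, v} L, (∀ i, M.carrier (σ i)) → ℝ) → Prop
  | ⟨_, c, s, φ, e, q⟩, G => ∀ A, G N A ≤ 0 →
    (∀ y, (q.1.1 : ℝ) ≤ φ.1.eval N (N.consTuple y fun k => N.sortFamily A (c k) (e k))) ∨
    ∃ j, φ.1.eval N (N.consTuple (N.sortFamily A s j)
      fun k => N.sortFamily A (c k) (e k)) ≤ q.1.2

/-- If F is compatible with a witness y for φ < q.2, then y is placed at a variable of the right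
sort that occurs neither in F nor among the parameters. Otherwise F < 0 forces the infimum to be at
least q.2; the gap q.1 < q.2 leaves room for an open condition. -/
theorem WitnessIndex.exists_decides
    {Φ : ∀ {n : ℕ} (c : Fin n → L.Sorts), Set (BasicFormula L c)} {σ : ℕ → L.Sorts}
    (hσ : ∀ s K, ∃ k ≥ K, σ k = s) (M N : MetricStructure.{u, v} L) (w : WitnessIndex Φ σ)
    {F : ∀ M : MetricStructure.{u, v} L, (∀ i, M.carrier (σ i)) → ℝ} (hF : IsFormulaFun σ F)
    (hsat : ∃ A, F M A < 0) :
    ∃ G, IsFormulaFun σ G ∧ w.Decides N G ∧ ∃ A, F M A < 0 ∧ G M A < 0 := by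
  obtain ⟨m, c, s, φ, e, q, hq⟩ := w
  by_cases hcase : ∃ A, F M A < 0 ∧
      ∃ y, φ.1.eval M (M.consTuple y fun k => M.sortFamily A (c k) (e k)) < q.2
  · obtain ⟨A, hA, y, hy⟩ := hcase
    obtain ⟨E, hE, hsupp⟩ := hF.exists_support
    obtain ⟨K, hK⟩ := (hE.union (finite_range fun k => (e k).1)).bddAbove
    obtain ⟨j, hj, rfl⟩ := hσ s (K + 1)
    have hj' : ∀ i ∈ E ∪ range fun k => (e k).1, i ≠ j := fun i hi => by
      have := hK hi
      omega
    refine ⟨fun M A => φ.1.eval M (M.consTuple (M.sortFamily A (σ j) ⟨j, rfl⟩)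
        fun k => M.sortFamily A (c k) (e k)) - q.2, ?_, ?_, Function.update A j y, ?_, ?_⟩
    · exact (φ.1.isFormulaFun.subst (IsTermFun.consTuple (.sortFamily σ ⟨j, rfl⟩) fun k =>
        .sortFamily σ (e k))).comp (f := fun t => t - q.2) (by fun_prop)
    · exact fun B hB => Or.inr ⟨⟨j, rfl⟩, by linarith⟩
    · rwa [hsupp M _ A fun i hi => Function.update_of_ne (hj' i (Or.inl hi)) _ _]
    · have h1 : (fun k => M.sortFamily (Function.update A j y) (c k) (e k)) =
          fun k => M.sortFamily A (c k) (e k) := by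
        funext k
        exact MetricStructure.sortFamily_update y (hj' _ (Or.inr ⟨k, rfl⟩))
      have h2 : M.sortFamily (Function.update A j y) (σ j) ⟨j, rfl⟩ = y :=
        Function.update_self ..
      simp only [h1, h2]
      linarith
  · push Not at hcase
    obtain ⟨A, hA⟩ := hsat
    have hqr : (q.1 : ℝ) < q.2 := by exact_mod_cast hq
    refine ⟨fun M A => q.1 - (BasicFormula.inf s φ.1).eval M fun k =>
      M.sortFamily A (c k) (e k), ?_, ?_, A, hA, ?_⟩
    · exact ((BasicFormula.inf s φ.1).isFormulaFun.subst fun k => .sortFamily σ (e k)).comp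
        (f := fun t => q.1 - t) (by fun_prop)
    · refine fun B hB => Or.inl fun y => ?_
      by_contra! hlt
      have := (φ.1.eval_inf_lt N (fun k => N.sortFamily B (c k) (e k)) q.1).2 ⟨y, hlt⟩
      linarith
    · by_contra! hge
      obtain ⟨y, hy⟩ := (φ.1.eval_inf_lt M (fun k => M.sortFamily A (c k) (e k)) q.2).1
        (by linarith)
      exact absurd hy (not_lt.2 (hcase A hA y))

/-- The omitting types theorem, for one type. -/
theorem IsSeparable.exists_omitting (hL : IsSeparable.{u, v} L) {T : Set (Sentence.{u, v} L)}
    (hT : IsCompleteTheory T) {n : ℕ} {d : Fin n → L.Sorts} {M₀ : MetricStructure.{u, v} L}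
    {a₀ : M₀.Tuple d} [Nonempty L.Sorts] (h : ¬ M₀.IsIsolated T a₀) :
    ∃ N ∈ Mod T, N.IsSeparable ∧ ∀ b : N.Tuple d, N.tp b ≠ M₀.tp a₀ := by
  have := hL.countable_sorts
  obtain ⟨Φ, hΦ⟩ := hL.exists_isDenseFamily
  obtain ⟨σ, hσ⟩ := exists_enumeration L.Sorts
  obtain ⟨M, hM⟩ := hT.1
  obtain ⟨ε, hε, havoid⟩ := MetricStructure.exists_avoiding hT h
  have := hΦ.countable_witnessIndex σ
  let Avoids : (∀ i, {j // σ j = d i}) →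
      (∀ M : MetricStructure.{u, v} L, (∀ i, M.carrier (σ i)) → ℝ) → Prop := fun e G =>
    ∃ ψ : BasicFormula L d, ψ.eval M₀ a₀ = 0 ∧ ∃ η > 0, ∀ N A, G N A ≤ 0 →
      ∀ y : N.Tuple d, dist (fun i => N.sortFamily A (d i) (e i) : N.Tuple d) y < ε →
        η ≤ |ψ.eval N y|
  -- There are two kinds of requirements: witnesses for the dense formulas, and avoidance of the
  -- type by each tuple from the family.
  obtain ⟨A, hA⟩ := M.exists_generic
    (fun k : WitnessIndex Φ σ ⊕ (∀ i, {j // σ j = d i}) =>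
      Sum.elim (WitnessIndex.Decides M.ultrapower) Avoids k) (by
      rintro (w | e) F hF hsat
      · exact w.exists_decides hσ M M.ultrapower hF hsat
      · exact havoid hF (fun i => .sortFamily σ (e i)) M hM hsat)
  have hTV : M.ultrapower.TarskiVaught fun s => range (M.ultrapower.sortFamily A s) := by
    refine hΦ.tarskiVaught fun m c s φ hφ x hx q ⟨y, hy⟩ => ?_
    choose e he using hx
    obtain rfl : (fun k => M.ultrapower.sortFamily A (c k) (e k)) = x := funext he
    -- As q' exceeds the value at y, the first alternative of the requirement for (q', q) fails, so
    -- the family contains a witness.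
    obtain ⟨q', hq1, hq2⟩ := exists_rat_btwn hy
    obtain ⟨G, hG, hGA⟩ := hA (.inl ⟨m, c, s, ⟨φ, hφ⟩, e, (q', q), by exact_mod_cast hq2⟩)
    rcases hG A hGA with h1 | ⟨j, hj⟩
    · exact absurd hq1 (not_lt.2 (h1 y))
    · exact ⟨_, ⟨j, rfl⟩, hj⟩
  refine ⟨hTV.substructure, (hTV.elemEquiv.mem_mod (M.ultrapower_elemEquiv.mem_mod hM)),
    hTV.isSeparable fun s => countable_range _, fun b hb => ?_⟩
  -- An arbitrary b of the closure is ε-close to a tuple of the family. Avoidance holds on the whole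
  -- ε-ball around that tuple, so |ψ(b)| ≥ η, whereas ψ vanishes on the type.
  have hclose : ∀ i, ∃ j, dist (M.ultrapower.sortFamily A (d i) j) (b i).1 < ε := by
    intro i
    obtain ⟨_, ⟨j, rfl⟩, hj⟩ := Metric.mem_closure_iff.1 (b i).2 ε hε
    exact ⟨j, by rwa [dist_comm]⟩
  choose e he using hclose
  obtain ⟨G, ⟨ψ, hψ, η, hη, hG⟩, hGA⟩ := hA (.inr e)
  have h1 := hG _ A hGA (fun i => (b i).1) ((dist_pi_lt_iff hε).2 he)
  rw [← hTV.eval_substructure ψ b, MetricStructure.tp_eq_iff.1 hb, hψ, abs_zero] at h1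
  linarith

end Generic

/-! ## The Ryll-Nardzewski theorem -/

/-- On empty tuples the distance is 0 in every case, because the supremum of no sort bounds is 0 as
well. This covers the case without variables, in which the language may have no sorts. -/
theorem isPrincipal_of_isEmpty (T : Set (Sentence.{u, v} L)) {d : Fin 0 → L.Sorts}
    (p : LFormula.{u, v} L d → ℝ) : IsPrincipal T p := by
  obtain ⟨φ, hφ⟩ := (IsFormulaFun.const.{u, v} d 0).exists_basic
  let φ' : BasicForm (Mod T) d := φ
  refine ⟨(φ' : TFormula T d), fun M a => ?_⟩
  rw [Form.eval_coe]
  refine (hφ M.1 a).trans ?_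
  rw [MetricStructure.distTo]
  split_ifs with hX
  · obtain ⟨b, hb⟩ := hX
    rw [Subsingleton.elim a b, Metric.infDist_zero_of_mem hb]
  · rw [Real.iSup_of_isEmpty]

/-- If the separable models of a complete theory are isomorphic, then they are atomic. -/
theorem IsSeparable.isAtomicModel_of_iso (hL : IsSeparable.{u, v} L)
    {T : Set (Sentence.{u, v} L)} (hT : IsCompleteTheory T)
    (h : ∀ M ∈ Mod T, ∀ N ∈ Mod T, M.IsSeparable → N.IsSeparable → Nonempty (M.Iso N))
    {M : MetricStructure.{u, v} L} (hM : M ∈ Mod T) (hMs : M.IsSeparable) : IsAtomicModel T M := by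
  refine ⟨hM, fun {n} c a => ?_⟩
  rcases n with - | n
  · exact isPrincipal_of_isEmpty T _
  by_contra hp
  have : Nonempty L.Sorts := ⟨c 0⟩
  obtain ⟨N, hN, hNs, homit⟩ := hL.exists_omitting hT
    (M₀ := M) (a₀ := a) fun hi => hp (hi.isPrincipal hT hM)
  obtain ⟨f⟩ := h M hM N hN hMs hNs
  exact homit (fun i => f.toFun _ (a i))
    (MetricStructure.tp_eq_iff.2 fun φ => (f.eval φ a).symm)

/-- If either model is compact, elementary equivalence alone yields the isomorphism; otherwise both
have density exactly ℵ₀ and categoricity applies. -/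
theorem IsSeparablyCategorical.nonempty_iso {T : Set (Sentence.{u, v} L)}
    (h : IsSeparablyCategorical T) (hT : IsCompleteTheory T) {M N : MetricStructure.{u, v} L}
    (hM : M ∈ Mod T) (hN : N ∈ Mod T) (hMs : M.IsSeparable) (hNs : N.IsSeparable) :
    Nonempty (M.Iso N) := by
  by_cases hNc : N.IsCompact
  · exact (hT.2 M hM N hN).nonempty_iso_of_isCompact hNc
  by_cases hMc : M.IsCompact
  · obtain ⟨f⟩ := (hT.2 N hN M hM).nonempty_iso_of_isCompact hMc
    refine absurd (fun s => ?_) hNc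
    have := hMc s
    exact (f.map_dist s).isClosedEmbedding.compactSpace
  · exact h.2 M hM N hN (MetricStructure.density_eq_of_not_isCompact hMs hMc)
      (MetricStructure.density_eq_of_not_isCompact hNs hNc)

/-- Omitting types gives one direction, since isomorphic models realize the same types, and
back-and-forth gives the other. -/
theorem IsSeparable.isSeparablyCategorical_iff (hL : IsSeparable.{u, v} L)
    {T : Set (Sentence.{u, v} L)} (hT : IsCompleteTheory T) :
    IsSeparablyCategorical T ↔ ∀ M ∈ Mod T, M.IsSeparable → IsAtomicModel T M := by
  constructor
  · exact fun h M hM hMs => hL.isAtomicModel_of_iso hT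
      (fun P hP Q hQ hPs hQs => h.nonempty_iso hT hP hQ hPs hQs) hM hMs
  · intro h
    have := hL.countable_sorts
    refine ⟨Cardinal.lift_le_aleph0.2 (hL.languageDensity_le T), fun M hM N hN hMd hNd => ?_⟩
    exact MetricStructure.nonempty_iso_of_isAtomicModel (h M hM hMd.le) (h N hN hNd.le) hMd.le
      hNd.le (hT.2 M hM N hN)

/-- This is Vaught's test: two models have separable elementarily equivalent companions, which are
again models of T, hence non-compact and of density ℵ₀. -/
theorem IsSeparable.isCompleteTheory_of_isSeparablyCategorical (hL : IsSeparable.{u, v} L)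
    {T : Set (Sentence.{u, v} L)} (hT : IsTheory T) (hc : ∀ M ∈ Mod T, ¬ M.IsCompact)
    (h : IsSeparablyCategorical T) : IsCompleteTheory T := by
  refine ⟨hT, fun M hM N hN => ?_⟩
  obtain ⟨M', hMs, hMe, -⟩ := hL.exists_isSeparable_elemEquiv M (d := Fin.elim0) fun i => i.elim0
  obtain ⟨N', hNs, hNe, -⟩ := hL.exists_isSeparable_elemEquiv N (d := Fin.elim0) fun i => i.elim0
  have hM' := hMe.mem_mod hM
  have hN' := hNe.mem_mod hN
  obtain ⟨f⟩ := h.2 M' hM' N' hN' (MetricStructure.density_eq_of_not_isCompact hMs (hc M' hM'))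
    (MetricStructure.density_eq_of_not_isCompact hNs (hc N' hN'))
  exact (hMe.symm.trans f.elemEquiv).trans hNe

end MetricLanguage

theorem mainTheorem5 (L : MetricLanguage.{u}) :
    (MetricLanguage.IsSeparable.{u, v} L →
      ∀ T : Set (MetricLanguage.Sentence.{u, v} L), MetricLanguage.IsTheory T →
        (∀ M ∈ MetricLanguage.Mod T, ¬ M.IsCompact) →
        (MetricLanguage.IsSeparablyCategorical T ↔
          MetricLanguage.IsCompleteTheory T ∧
            ∀ (n : ℕ) (c : Fin n → L.Sorts), ∀ p ∈ MetricLanguage.TypeSpace T c,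
              MetricLanguage.IsPrincipal T p)) ∧
    (Countable L.Sorts →
      ∀ T : Set (MetricLanguage.Sentence.{u, v} L),
        ∀ M N : MetricLanguage.MetricStructure.{u, v} L,
          MetricLanguage.IsAtomicModel T M → MetricLanguage.IsAtomicModel T N →
          M.IsSeparable → N.IsSeparable → M.ElemEquiv N → Nonempty (M.Iso N)) ∧
    (MetricLanguage.IsSeparable.{u, v} L →
      ∀ T : Set (MetricLanguage.Sentence.{u, v} L), MetricLanguage.IsCompleteTheory T →
        (MetricLanguage.IsSeparablyCategorical T ↔
          ∀ M ∈ MetricLanguage.Mod T, M.IsSeparable → MetricLanguage.IsAtomicModel T M)) := by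
  refine ⟨fun hL T hT hc => ⟨fun h => ?_, fun h => ?_⟩, fun hS T M N hM hN hMs hNs h => ?_,
    fun hL T hT => hL.isSeparablyCategorical_iff hT⟩
  · have hTc := hL.isCompleteTheory_of_isSeparablyCategorical hT hc h
    refine ⟨hTc, ?_⟩
    rintro n c _ ⟨M, hM, a, rfl⟩
    -- The model M may be non-separable; Löwenheim–Skolem provides a realization of the same type in
    -- a separable model, which is atomic.
    obtain ⟨N, hNs, hNe, b, hb⟩ := hL.exists_isSeparable_elemEquiv M a
    rw [← hb]
    exact ((hL.isSeparablyCategorical_iff hTc).1 h N (hNe.mem_mod hM) hNs).2 c b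
  · exact (hL.isSeparablyCategorical_iff h.1).2 fun M hM _ =>
      ⟨hM, fun {n} c a => h.2 n c _ ⟨M, hM, a, rfl⟩⟩
  · exact MetricLanguage.MetricStructure.nonempty_iso_of_isAtomicModel hM hN hMs hNs h
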